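/- Let $m\ge 2$ and let $D$ and $\Omega$ be bounded open domains (non-empty, connected, open, bounded sets) in $\mathbb{R}^m$ with $C^1$ boundaries. Assume that $\partial\Omega$ can be singly parametrized: there are a Jordan measurable bounded closed domain $U\subset\mathbb{R}^{m-1}$ (the closure of a domain, with a boundary of measure zero) and a $C^1$ map $x:U\to\mathbb{R}^m$ with $x(U)=\partial\Omega$ that, on the interior of $U$, is injective and has a Jacobian matrix of rank $m-1$. Let $\varphi:\overline{\Omega}\to\overline{D}$ be a $C^1$ map that maps $\partial\Omega$ onto $\partial D$ diffeomorphically (a $C^1$ bijection with $C^1$ inverse); $\varphi$ need not be injective in $\Omega$. Orient $\partial\Omega$ and $\partial D$ by their unit outer normals $n$: a basis $\tau_1,\dots,\tau_{m-1}$ of the tangent space at a boundary point is positive (negative) if $\det(n,\tau_1,\dots,\tau_{m-1})$ is positive (negative). Then $\varphi$ either preserves the orientation of the boundaries (for every $p\in\partial\Omega$, $\varphi'(p)$ sends positive bases of $T_p\partial\Omega$ to positive bases of $T_{\varphi(p)}\partial D$) or reverses it (for every $p\in\partial\Omega$, $\varphi'(p)$ sends positive bases to negative ones), and for every $f\in C(\overline{D})$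 (real-valued), with $J_\varphi=\det\varphi'$, the functions $f$ and $(f\circ\varphi)J_\varphi$ are integrable on $D$ and $\Omega$ respectively, and $$\int_D f(y)\,dy=\pm\int_\Omega f(\varphi(x))\,J_\varphi(x)\,dx,$$ where the sign is $+$ if $\varphi$ preserves the orientation of the boundaries and $-$ if $\varphi$ reverses it. -/

import Mathlib

open Set Filter Topology MeasureTheory

noncomputable section

/-- A bounded open domain: a non-empty, connected, open and bounded set. -/
structure IsBoundedDomain {n : ℕ} (Ω : Set (EuclideanSpace ℝ (Fin n))) : Prop where
  isOpen : IsOpen Ω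
  isConnected : IsConnected Ω
  isBounded : Bornology.IsBounded Ω

/-- `ρ` is a `C¹` local defining function of `Ω` at `p`: it is `C¹` near `p`, vanishes at `p` with
non-zero differential, and near `p` the set `Ω` is exactly `{ρ < 0}`. -/
structure IsLocalDefiningFunction {n : ℕ} (Ω : Set (EuclideanSpace ℝ (Fin n)))
    (p : EuclideanSpace ℝ (Fin n)) (ρ : EuclideanSpace ℝ (Fin n) → ℝ) : Prop where
  contDiffAt : ContDiffAt ℝ 1 ρ p
  eq_zero : ρ p = 0
  gradient_ne_zero : gradient ρ p ≠ 0
  mem_iff : ∀ᶠ x in 𝓝 p, (x ∈ Ω ↔ ρ x < 0)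

/-- `Ω` has a `C¹` boundary: near each boundary point it is one side of a `C¹` hypersurface. -/
def HasC1Boundary {n : ℕ} (Ω : Set (EuclideanSpace ℝ (Fin n))) : Prop :=
  ∀ p ∈ frontier Ω, ∃ ρ, IsLocalDefiningFunction Ω p ρ

/-- `ν` is the unit outer normal vector of `Ω` at the boundary point `p`. -/
def IsUnitOuterNormal {n : ℕ} (Ω : Set (EuclideanSpace ℝ (Fin n)))
    (p ν : EuclideanSpace ℝ (Fin n)) : Prop :=
  ∃ ρ, IsLocalDefiningFunction Ω p ρ ∧ ν = ‖gradient ρ p‖⁻¹ • gradient ρ p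

/-- `x : U → ℝᵈ⁺¹` is a `C¹`-parametrized surface: `U` is a Jordan measurable bounded closed domain
of `ℝᵈ` (the closure of a domain, with null boundary), `x` is `C¹` on `U`, and on the interior of
`U` it is injective with a Jacobian matrix of rank `d`. -/
structure IsC1ParametrizedSurface {d : ℕ} (U : Set (EuclideanSpace ℝ (Fin d)))
    (x : EuclideanSpace ℝ (Fin d) → EuclideanSpace ℝ (Fin (d + 1))) : Prop where
  isBounded : Bornology.IsBounded U
  eq_closure : U = closure (interior U)
  isConnected : IsConnected (interior U)
  jordan : volume (frontier U) = 0
  contDiffOn : ContDiffOn ℝ 1 x U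
  injOn : InjOn x (interior U)
  rank_eq : ∀ u ∈ interior U, Module.finrank ℝ (fderiv ℝ x u).toLinearMap.range = d

/-- The set `S` can be singly parametrized: it is the image of one `C¹`-parametrized surface. -/
def IsSinglyParametrized {d : ℕ} (S : Set (EuclideanSpace ℝ (Fin (d + 1)))) : Prop :=
  ∃ (U : Set (EuclideanSpace ℝ (Fin d)))
    (x : EuclideanSpace ℝ (Fin d) → EuclideanSpace ℝ (Fin (d + 1))),
    IsC1ParametrizedSurface U x ∧ x '' U = S

/-- `φ` maps `S` onto `T` diffeomorphically (in the class `C¹`): it is a `C¹` bijection of `S` onto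
`T` with `C¹` inverse. -/
def MapsDiffeomorphically {n : ℕ}
    (φ : EuclideanSpace ℝ (Fin n) → EuclideanSpace ℝ (Fin n))
    (S T : Set (EuclideanSpace ℝ (Fin n))) : Prop :=
  BijOn φ S T ∧ ContDiffOn ℝ 1 φ S ∧
    ∃ ψ : EuclideanSpace ℝ (Fin n) → EuclideanSpace ℝ (Fin n),
      InvOn ψ φ S T ∧ ContDiffOn ℝ 1 ψ T

/-- The determinant `det (ν, τ₁, …, τ_d)` of `d + 1` vectors of `ℝᵈ⁺¹`. When `ν` is the unit outer
normal of a domain at a boundary point, a family `τ` of tangent vectors is a positively (negatively)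
oriented basis of the tangent space of the boundary iff this number is positive (negative). -/
def boundaryDet {d : ℕ} (ν : EuclideanSpace ℝ (Fin (d + 1)))
    (τ : Fin d → EuclideanSpace ℝ (Fin (d + 1))) : ℝ :=
  Matrix.det (Matrix.of fun i j : Fin (d + 1) =>
    (Fin.cons ν τ : Fin (d + 1) → EuclideanSpace ℝ (Fin (d + 1))) j i)

/-- `φ` preserves the orientation of the boundaries: at each `p ∈ ∂Ω` its differential sends
positively oriented bases of `T_p ∂Ω` to positively oriented bases of `T_{φ p} ∂D`, where the
boundaries are oriented by their outer normals. -/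
def PreservesBoundaryOrientation {d : ℕ} (Ω D : Set (EuclideanSpace ℝ (Fin (d + 1))))
    (φ : EuclideanSpace ℝ (Fin (d + 1)) → EuclideanSpace ℝ (Fin (d + 1))) : Prop :=
  ∀ p ∈ frontier Ω, ∀ ν μ : EuclideanSpace ℝ (Fin (d + 1)),
    IsUnitOuterNormal Ω p ν → IsUnitOuterNormal D (φ p) μ →
    ∀ τ : Fin d → EuclideanSpace ℝ (Fin (d + 1)), (∀ i, inner ℝ ν (τ i) = 0) →
      0 < boundaryDet ν τ →
      0 < boundaryDet μ (fun i => fderivWithin ℝ φ (closure Ω) p (τ i))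

/-- `φ` reverses the orientation of the boundaries: at each `p ∈ ∂Ω` its differential sends
positively oriented bases of `T_p ∂Ω` to negatively oriented bases of `T_{φ p} ∂D`. -/
def ReversesBoundaryOrientation {d : ℕ} (Ω D : Set (EuclideanSpace ℝ (Fin (d + 1))))
    (φ : EuclideanSpace ℝ (Fin (d + 1)) → EuclideanSpace ℝ (Fin (d + 1))) : Prop :=
  ∀ p ∈ frontier Ω, ∀ ν μ : EuclideanSpace ℝ (Fin (d + 1)),
    IsUnitOuterNormal Ω p ν → IsUnitOuterNormal D (φ p) μ →
    ∀ τ : Fin d → EuclideanSpace ℝ (Fin (d + 1)), (∀ i, inner ℝ ν (τ i) = 0) →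
      0 < boundaryDet ν τ →
      boundaryDet μ (fun i => fderivWithin ℝ φ (closure Ω) p (τ i)) < 0

end

/-!
The proof computes a degree with integrals only; no form of Stokes' theorem is used.

For a `C¹` map `g` on a bounded open set `W` and a function `f`, consider
`∫_W f(g(x)) J_g(x) dx` (`pullbackIntegral`). The integral of a Jacobian determinant does not change
when the map is perturbed on a compact subset of `W` (`setIntegral_det_fderiv_sub_eq_zero`). This
reduces to `∫ det DG = 0` for compactly supported `G`: for large `s` the map `s + G` is a bijection
that maps a large ball onto its dilate, so that `∫ det (s + DG) = sⁿ vol`, and both sides are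
polynomials in `s`, which gives the value at `s = 0`. If `f = det DΦ`, then `f(g) J_g = J_{Φ ∘ g}`,
and the integral is invariant under homotopies of `g` whose boundary values avoid the support of `f`
(`setIntegral_homotopy_eq_zero`). Products of one-dimensional bumps are of the form `det DΦ`, and
they form an approximate identity, so on a connected open set that misses `g(∂W)` the functional
`f ↦ ∫_W f(g) J_g` is a constant multiple, the degree, of the integral (`exists_degree`).

It remains to find the degree `k` of `φ` over `D`. The differential of `φ` maps the tangent space of
`∂Ω` at `p` isomorphically onto that of `∂D` at `φ p`, because the boundary map has a `C¹` inverse.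
Hence its Jacobian with respect to the two orientations (`boundaryJacobian`) has no zeros, and its
sign `σ` is constant on the boundary, which is connected as the image of a connected parameter
domain. To `φ` one adds a large multiple of the outer normal of `D` at `φ p` times a defining
function of `Ω` cut off near `p` (`exists_perturbation`). The sum has the boundary values of `φ`,
hence the same degrees off `∂D`, and near `p` it is a diffeomorphism into `D` whose Jacobian has the sign `σ`. The
remaining part of `Ω` contributes a degree that is constant near `φ p`; so the degree jumps by `σ`
across `∂D`. As `φ` takes no values outside of the closure of `D`, the degree is `0` there, and
`k = σ` (`pullbackIntegral_eq_sign_mul_integral`).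

Functions without compact support in `D` are reached by cutoffs. At the points of `Ω` that `φ` sends
to `∂D` the Jacobian vanishes (`det_fderiv_eq_zero_of_mem_frontier`), since otherwise `φ` would be
open there and take values outside of the closure of `D`.
-/

/-! ### The integral of a Jacobian determinant under perturbations of the map -/

section NullLagrangian

variable {E : Type*} [NormedAddCommGroup E] [NormedSpace ℝ E] [FiniteDimensional ℝ E]

theorem det_smul_id_add_ne_zero {s : ℝ} {A : E →L[ℝ] E} (h : ‖A‖ < s) :
    (s • ContinuousLinearMap.id ℝ E + A).det ≠ 0 := by
  intro h0
  obtain ⟨v, hv, hv0⟩ := (Submodule.ne_bot_iff _).1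
    (LinearMap.bot_lt_ker_of_det_eq_zero (f := ((s • ContinuousLinearMap.id ℝ E + A : E →L[ℝ] E) :
      E →ₗ[ℝ] E)) h0).ne'
  have h1 : s • v = -A v := by
    have : s • v + A v = 0 := by simpa using hv
    exact eq_neg_of_add_eq_zero_left this
  have hs : 0 < s := (norm_nonneg A).trans_lt h
  have h2 : s * ‖v‖ = ‖A v‖ := by
    have := congrArg norm h1
    rwa [norm_smul, norm_neg, Real.norm_of_nonneg hs.le] at this
  have h3 := A.le_opNorm v
  have : 0 < ‖v‖ := norm_pos_iff.2 hv0
  nlinarith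

theorem det_smul_id_add_pos {s : ℝ} {A : E →L[ℝ] E} (h : ‖A‖ < s) :
    0 < (s • ContinuousLinearMap.id ℝ E + A).det := by
  have hs : 0 < s := (norm_nonneg A).trans_lt h
  by_contra hneg
  have hc : ContinuousOn (fun t : ℝ => (s • ContinuousLinearMap.id ℝ E + t • A).det) (Icc 0 1) :=
    (ContinuousLinearMap.continuous_det.comp (by fun_prop)).continuousOn
  have h0 : (0 : ℝ) ∈ Icc ((s • ContinuousLinearMap.id ℝ E + (1 : ℝ) • A).det)
      ((s • ContinuousLinearMap.id ℝ E + (0 : ℝ) • A).det) := by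
    refine ⟨by simpa using hneg, ?_⟩
    rw [zero_smul, add_zero]
    simp only [ContinuousLinearMap.det, ContinuousLinearMap.toLinearMap_smul,
      ContinuousLinearMap.coe_id, LinearMap.det_smul, LinearMap.det_id]
    positivity
  obtain ⟨t, ht, h1⟩ := intermediate_value_Icc' zero_le_one hc h0
  refine det_smul_id_add_ne_zero (s := s) (A := t • A) ?_ h1
  rw [norm_smul, Real.norm_of_nonneg ht.1]
  exact (mul_le_of_le_one_left (norm_nonneg _) ht.2).trans_lt h

/-- The determinant is recovered from its values on translates by large multiples of the identity,
with universal weights: `s ↦ det (s + A)` is a polynomial of degree `dim E`, so its value at `0` is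
a fixed linear combination of its values at `dim E + 1` nodes. -/
theorem exists_det_eq_sum (r : ℝ) : ∃ (N : ℕ) (c s : ℕ → ℝ), (∀ i, r < s i) ∧
    ∀ A : E →L[ℝ] E,
      A.det = ∑ i ∈ Finset.range N, c i * (s i • ContinuousLinearMap.id ℝ E + A).det := by
  set N := Module.finrank ℝ E + 1
  set s : ℕ → ℝ := fun i => r + 1 + i
  refine ⟨N, fun i => (Lagrange.basis (Finset.range N) s i).eval 0, s, fun i => ?_, fun A => ?_⟩
  · have : (0 : ℝ) ≤ i := i.cast_nonneg
    simp only [s]; linarith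
  have hev : ∀ t : ℝ, (-(A : E →ₗ[ℝ] E)).charpoly.eval t =
      (t • ContinuousLinearMap.id ℝ E + A).det := by
    intro t
    rw [LinearMap.eval_charpoly, ContinuousLinearMap.det]
    congr 1
    ext v
    simp [Algebra.algebraMap_eq_smul_one]
  have h1 := Lagrange.eq_interpolate (s := Finset.range N) (v := s)
    (f := (-(A : E →ₗ[ℝ] E)).charpoly) (fun i _ j _ hij => by simpa [s] using hij) (by
      refine Polynomial.degree_le_natDegree.trans_lt ?_
      rw [LinearMap.charpoly_natDegree, Finset.card_range]
      exact_mod_cast Nat.lt_succ_self _)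
  have h2 := congrArg (Polynomial.eval 0) h1
  rw [hev, Lagrange.interpolate_apply, Polynomial.eval_finsetSum] at h2
  rw [zero_smul, zero_add] at h2
  rw [h2]
  refine Finset.sum_congr rfl fun i _ => ?_
  rw [Polynomial.eval_mul, Polynomial.eval_C, hev, mul_comm]

/-- A smooth cutoff, equal to `1` near a compact set and compactly supported in a given open set
around it. -/
theorem exists_contDiff_cutoff {K W : Set E} (hK : IsCompact K) (hW : IsOpen W) (hKW : K ⊆ W) :
    ∃ ζ : E → ℝ, ContDiff ℝ 1 ζ ∧ HasCompactSupport ζ ∧ tsupport ζ ⊆ W ∧ (∀ x, ζ x ∈ Icc 0 1) ∧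
      ∀ x ∈ K, ζ =ᶠ[𝓝 x] 1 := by
  obtain ⟨L, hL, hKL, hLW⟩ := exists_compact_between hK hW hKW
  obtain ⟨ζ, h1, h0, h01⟩ := exists_contMDiffMap_one_nhds_of_subset_interior (n := 1)
    (modelWithCornersSelf ℝ E) hK.isClosed hKL
  have hsupp : tsupport ζ ⊆ L :=
    closure_minimal (fun x hx => by_contra fun h => hx (h0 x h)) hL.isClosed
  refine ⟨ζ, contMDiff_iff_contDiff.1 ζ.contMDiff,
    hL.of_isClosed_subset (isClosed_tsupport _) hsupp, hsupp.trans hLW, h01, fun x hx => ?_⟩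
  exact h1.filter_mono (nhds_le_nhdsSet hx)

variable [MeasurableSpace E] [BorelSpace E] (μ : Measure E) [μ.IsAddHaarMeasure]

/-- For large `s` the map `s + G` is a bijection of space that agrees with the dilation by `s` off
the ball; it therefore maps the ball onto the dilated ball. -/
theorem integral_det_smul_id_add_fderiv {G : E → E} (hG : ContDiff ℝ 1 G) {C : NNReal}
    (hC : LipschitzWith C G) {R : ℝ} (hR : ∀ x, x ∉ Metric.ball (0 : E) R → G x = 0) {s : ℝ}
    (hs : (C : ℝ) < s) :
    ∫ x in Metric.ball (0 : E) R, (s • ContinuousLinearMap.id ℝ E + fderiv ℝ G x).det ∂μ =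
      s ^ Module.finrank ℝ E * μ.real (Metric.ball (0 : E) R) := by
  have hs0 : 0 < s := C.coe_nonneg.trans_lt hs
  set F : E → E := fun x => s • x + G x
  have hF : ∀ x, HasFDerivAt F (s • ContinuousLinearMap.id ℝ E + fderiv ℝ G x) x := fun x =>
    ((hasFDerivAt_id x).const_smul s).add (hG.differentiable one_ne_zero x).hasFDerivAt
  have hinj : Function.Injective F := by
    intro x y hxy
    by_contra hne
    have h1 : s • (x - y) = G y - G x := by
      simp only [F] at hxy
      rw [smul_sub, sub_eq_sub_iff_add_eq_add, hxy, add_comm]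
    have h2 := hC.dist_le_mul y x
    rw [dist_eq_norm, ← h1, norm_smul, Real.norm_of_nonneg hs0.le, dist_comm, dist_eq_norm] at h2
    have : 0 < ‖x - y‖ := norm_pos_iff.2 (sub_ne_zero.2 hne)
    nlinarith
  have hsurj : Function.Surjective F := by
    intro y
    have hcon : ContractingWith (⟨s⁻¹, by positivity⟩ * C : NNReal) fun x => s⁻¹ • (y - G x) := by
      refine ⟨?_, ?_⟩
      · rw [← NNReal.coe_lt_coe]
        change s⁻¹ * (C : ℝ) < 1
        rw [inv_mul_lt_iff₀ hs0]; linarith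
      · refine LipschitzWith.of_dist_le_mul fun a b => ?_
        change _ ≤ s⁻¹ * (C : ℝ) * _
        rw [dist_smul₀, dist_sub_left, Real.norm_of_nonneg (by positivity), mul_assoc]
        gcongr
        exact hC.dist_le_mul a b
    refine ⟨hcon.fixedPoint _, ?_⟩
    have h1 := hcon.fixedPoint_isFixedPt
    set x := hcon.fixedPoint _
    have h2 : s⁻¹ • (y - G x) = x := h1
    change s • x + G x = y
    conv_lhs => rw [← h2]
    rw [smul_inv_smul₀ hs0.ne', h2]
    abel
  have himg : F '' Metric.ball (0 : E) R = Metric.ball (0 : E) (s * R) := by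
    have hout : ∀ x, x ∉ Metric.ball (0 : E) R → F x ∉ Metric.ball (0 : E) (s * R) := by
      intro x hx
      have : F x = s • x := by simp [F, hR x hx]
      simp only [Metric.mem_ball, dist_zero_right, not_lt] at hx
      rw [this, Metric.mem_ball, dist_zero_right, norm_smul, Real.norm_of_nonneg hs0.le, not_lt]
      gcongr
    refine Subset.antisymm ?_ fun y hy => ?_
    · rintro _ ⟨x, hx, rfl⟩
      by_contra hy
      have h0 : s⁻¹ • F x ∉ Metric.ball (0 : E) R := by
        simp only [Metric.mem_ball, dist_zero_right, not_lt] at hy ⊢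
        rw [norm_smul, Real.norm_of_nonneg (by positivity)]
        rwa [← div_eq_inv_mul, le_div_iff₀' hs0]
      have h1 : F x = F (s⁻¹ • F x) := by
        change F x = s • (s⁻¹ • F x) + G _
        rw [hR _ h0, smul_inv_smul₀ hs0.ne', add_zero]
      exact h0 (hinj h1 ▸ hx)
    · obtain ⟨x, rfl⟩ := hsurj y
      exact ⟨x, by_contra fun hx => hout x hx hy, rfl⟩
  have h1 := integral_image_eq_integral_abs_det_fderiv_smul μ (measurableSet_ball (x := (0 : E))
    (ε := R)) (fun x _ => (hF x).hasFDerivWithinAt) hinj.injOn (fun _ => (1 : ℝ))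
  rw [himg] at h1
  have h2 : ∀ x, |(s • ContinuousLinearMap.id ℝ E + fderiv ℝ G x).det| • (1 : ℝ) =
      (s • ContinuousLinearMap.id ℝ E + fderiv ℝ G x).det := fun x => by
    rw [smul_eq_mul, mul_one, abs_of_pos]
    exact det_smul_id_add_pos ((norm_fderiv_le_of_lipschitz ℝ hC).trans_lt hs)
  simp only [h2] at h1
  rw [← h1]
  simp only [integral_const, smul_eq_mul, mul_one, measureReal_restrict_apply_univ]
  rw [measureReal_def, measureReal_def, Measure.addHaar_ball_mul_of_pos μ 0 hs0, ENNReal.toReal_mul,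
    ENNReal.toReal_ofReal (by positivity)]

/-- The integral of the Jacobian determinant of a compactly supported map vanishes, except in
dimension zero, where the determinant is `1`. -/
theorem integral_det_fderiv_eq_zero [Nontrivial E] {G : E → E} (hG : ContDiff ℝ 1 G)
    (hc : HasCompactSupport G) : ∫ x, (fderiv ℝ G x).det ∂μ = 0 := by
  obtain ⟨C, hC⟩ := hG.lipschitzWith_of_hasCompactSupport hc one_ne_zero
  obtain ⟨R, hR0, hR⟩ := hc.isCompact.isBounded.subset_ball_lt 0 (0 : E)
  have hfin : Module.finrank ℝ E ≠ 0 := Module.finrank_pos.ne'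
  have hcont : Continuous (fderiv ℝ G) := hG.continuous_fderiv one_ne_zero
  have hout : ∀ x, x ∉ Metric.ball (0 : E) R → (fderiv ℝ G x).det = 0 := by
    intro x hx
    rw [image_eq_zero_of_notMem_tsupport fun h => hx (hR (tsupport_fderiv_subset ℝ h))]
    simp [ContinuousLinearMap.det]
  obtain ⟨N, c, s, hs, hdet⟩ := exists_det_eq_sum (E := E) C
  rw [← setIntegral_eq_integral_of_forall_compl_eq_zero hout]
  simp only [hdet (fderiv ℝ G _)]
  rw [integral_finsetSum]
  · simp only [integral_const_mul, integral_det_smul_id_add_fderiv μ hG hC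
      (fun x hx => image_eq_zero_of_notMem_tsupport fun h => hx (hR h)) (hs _)]
    have h0 := hdet 0
    simp only [add_zero, ContinuousLinearMap.det, ContinuousLinearMap.toLinearMap_smul,
      ContinuousLinearMap.coe_id, LinearMap.det_smul, LinearMap.det_id, mul_one,
      ContinuousLinearMap.toLinearMap_zero, LinearMap.det_zero, zero_pow hfin] at h0
    simp only [← mul_assoc]
    rw [← Finset.sum_mul, ← h0, zero_mul]
  · intro i _
    refine Integrable.const_mul ?_ _
    have : Continuous fun x => (s i • ContinuousLinearMap.id ℝ E + fderiv ℝ G x).det :=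
      ContinuousLinearMap.continuous_det.comp (by fun_prop)
    exact this.continuousOn.integrableOn_of_subset_isCompact (isCompact_closedBall 0 R)
      measurableSet_ball Metric.ball_subset_closedBall measure_ball_lt_top.ne

/-- The integral of the Jacobian determinant is unchanged by a compactly supported perturbation of
the map. -/
theorem setIntegral_det_fderiv_sub_eq_zero [Nontrivial E] {W K : Set E} (hW : IsOpen W)
    (hK : IsCompact K) (hKW : K ⊆ W) {G₀ G₁ : E → E} (h₀ : ContDiffOn ℝ 1 G₀ W)
    (h₁ : ContDiffOn ℝ 1 G₁ W) (heq : ∀ x ∈ W, x ∉ K → G₁ x = G₀ x) :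
    ∫ x in W, ((fderiv ℝ G₁ x).det - (fderiv ℝ G₀ x).det) ∂μ = 0 := by
  obtain ⟨ζ, hζ, hζc, hζW, -, hζ1⟩ := exists_contDiff_cutoff hK hW hKW
  have hsupp : ∀ G : E → E, tsupport (fun x => ζ x • G x) ⊆ tsupport ζ := fun G =>
    closure_mono (Function.support_smul_subset_left ζ G)
  have hcd : ∀ {G : E → E}, ContDiffOn ℝ 1 G W → ContDiff ℝ 1 fun x => ζ x • G x := by
    intro G hG
    refine contMDiff_iff_contDiff.1 (contMDiff_of_tsupport fun x hx => ?_)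
    refine contMDiffAt_iff_contDiffAt.2 ?_
    exact hζ.contDiffAt.smul (hG.contDiffAt (hW.mem_nhds (hζW (hsupp G hx))))
  have hcs : ∀ G : E → E, HasCompactSupport fun x => ζ x • G x := fun G =>
    hζc.of_isClosed_subset (isClosed_tsupport _) (hsupp G)
  have hint : ∀ {G : E → E}, ContDiffOn ℝ 1 G W →
      Integrable (fun x => (fderiv ℝ (fun x => ζ x • G x) x).det) μ := by
    intro G hG
    refine Continuous.integrable_of_hasCompactSupport
      (ContinuousLinearMap.continuous_det.comp ((hcd hG).continuous_fderiv one_ne_zero)) ?_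
    exact ((hcs G).fderiv ℝ).comp_left (g := ContinuousLinearMap.det)
      (by simp [ContinuousLinearMap.det])
  have key : ∀ x, W.indicator (fun x => (fderiv ℝ G₁ x).det - (fderiv ℝ G₀ x).det) x =
      (fderiv ℝ (fun x => ζ x • G₁ x) x).det - (fderiv ℝ (fun x => ζ x • G₀ x) x).det := by
    intro x
    by_cases hx : x ∈ K
    · have h : ∀ G : E → E, fderiv ℝ (fun x => ζ x • G x) x = fderiv ℝ G x := fun G =>
        Filter.EventuallyEq.fderiv_eq ((hζ1 x hx).mono fun y hy => by simp [hy])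
      rw [indicator_of_mem (hKW hx), h, h]
    · have h : (fun x => ζ x • G₁ x) =ᶠ[𝓝 x] fun x => ζ x • G₀ x := by
        filter_upwards [hK.isClosed.isOpen_compl.mem_nhds hx] with y hy
        by_cases hyW : y ∈ W
        · rw [heq y hyW hy]
        · rw [image_eq_zero_of_notMem_tsupport fun h => hyW (hζW h), zero_smul, zero_smul]
      rw [h.fderiv_eq, sub_self, indicator_apply_eq_zero]
      intro hxW
      have h : G₁ =ᶠ[𝓝 x] G₀ := by
        filter_upwards [hK.isClosed.isOpen_compl.mem_nhds hx, hW.mem_nhds hxW] with y hy hyW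
          using heq y hyW hy
      rw [h.fderiv_eq, sub_self]
  rw [← integral_indicator hW.measurableSet]
  simp only [key]
  rw [integral_sub (hint h₁) (hint h₀), integral_det_fderiv_eq_zero μ (hcd h₁) (hcs _),
    integral_det_fderiv_eq_zero μ (hcd h₀) (hcs _), sub_zero]

/-- Homotopy invariance: for `F = det DΦ`, the integral of `(F ∘ g) det Dg` does not change when
`g` is moved to `g + v` along a segment during which the boundary values of the map stay away from
the support of `F`. -/
theorem setIntegral_homotopy_eq_zero [Nontrivial E] {W : Set E} (hW : IsOpen W)
    (hWb : Bornology.IsBounded W) {g v Φ : E → E} (hg : ContDiffOn ℝ 1 g W)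
    (hgc : ContinuousOn g (closure W)) (hv : ContDiffOn ℝ 1 v W) (hvc : ContinuousOn v (closure W))
    (hΦ : ContDiff ℝ 1 Φ)
    (hsep : ∀ x ∈ frontier W, ∀ t ∈ Icc (0 : ℝ) 1,
      g x + t • v x ∉ tsupport fun y => (fderiv ℝ Φ y).det) :
    ∫ x in W, ((fderiv ℝ Φ (g x + v x)).det * (fderiv ℝ (fun x => g x + v x) x).det -
      (fderiv ℝ Φ (g x)).det * (fderiv ℝ g x).det) ∂μ = 0 := by
  set F : E → ℝ := fun y => (fderiv ℝ Φ y).det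
  -- the points at which some stage of the homotopy meets the support form a compact subset of `W`
  set K' : Set (E × ℝ) := (closure W ×ˢ Icc (0 : ℝ) 1) ∩
    (fun p : E × ℝ => g p.1 + p.2 • v p.1) ⁻¹' tsupport F
  have hWc : IsCompact (closure W) := hWb.isCompact_closure
  have hK' : IsCompact K' := by
    have hc : ContinuousOn (fun p : E × ℝ => g p.1 + p.2 • v p.1) (closure W ×ˢ Icc (0 : ℝ) 1) :=
      (hgc.comp continuousOn_fst fun p hp => hp.1).add
        (continuousOn_snd.smul (hvc.comp continuousOn_fst fun p hp => hp.1))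
    exact (hWc.prod isCompact_Icc).of_isClosed_subset
      (hc.preimage_isClosed_of_isClosed (isClosed_closure.prod isClosed_Icc) (isClosed_tsupport _))
      inter_subset_left
  set K : Set E := Prod.fst '' K'
  have hK : IsCompact K := hK'.image continuous_fst
  have hKW : K ⊆ W := by
    rintro _ ⟨⟨x, t⟩, ⟨⟨hx, ht⟩, hF⟩, rfl⟩
    by_contra hxW
    exact hsep x ⟨hx, by rwa [hW.interior_eq]⟩ t ht hF
  have hKF : ∀ x ∈ W, x ∉ K → ∀ t ∈ Icc (0 : ℝ) 1, F (g x + t • v x) = 0 := by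
    intro x hx hxK t ht
    refine image_eq_zero_of_notMem_tsupport fun h => hxK ?_
    exact ⟨(x, t), ⟨⟨subset_closure hx, ht⟩, h⟩, rfl⟩
  -- cutting off `v` outside `K` changes neither integrand: there both are zero, as `ζ x ∈ [0, 1]`
  obtain ⟨ζ, hζ, hζc, hζW, hζ01, hζ1⟩ := exists_contDiff_cutoff hK hW hKW
  set g₁ : E → E := fun x => g x + ζ x • v x
  have hg₁ : ContDiffOn ℝ 1 g₁ W := hg.add (hζ.contDiffOn.smul hv)
  have h1 := setIntegral_det_fderiv_sub_eq_zero μ hW hζc hζW (hΦ.comp_contDiffOn hg)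
    (hΦ.comp_contDiffOn hg₁) (fun x _ hx => by
      simp only [g₁, Function.comp_apply, image_eq_zero_of_notMem_tsupport hx, zero_smul, add_zero])
  rw [← h1]
  refine setIntegral_congr_fun hW.measurableSet fun x hx => ?_
  have hdet : ∀ {G : E → E}, ContDiffOn ℝ 1 G W →
      (fderiv ℝ (Φ ∘ G) x).det = F (G x) * (fderiv ℝ G x).det := by
    intro G hG
    rw [fderiv_comp x (hΦ.differentiable one_ne_zero _)
      ((hG.contDiffAt (hW.mem_nhds hx)).differentiableAt one_ne_zero)]
    exact LinearMap.det_comp _ _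
  simp only [hdet hg, hdet hg₁]
  congr 1
  change F _ * _ = _
  by_cases hxK : x ∈ K
  · have h : (fun x => g x + v x) =ᶠ[𝓝 x] g₁ := (hζ1 x hxK).mono fun y hy => by
      simp only [g₁, hy, Pi.one_apply, one_smul]
    have h' : g x + v x = g₁ x := h.self_of_nhds
    rw [h.fderiv_eq, h']
  · have h2 := hKF x hx hxK 1 (by simp)
    rw [one_smul] at h2
    rw [h2, hKF x hx hxK (ζ x) (hζ01 x), zero_mul, zero_mul]

end NullLagrangian

/-! ### Mollifying kernels that are Jacobian determinants -/

section Bump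

/-- `η` is a mollifying kernel supported in the ball of radius `ε` that is the Jacobian determinant
of a `C¹` map of the space. The last condition makes the change of variables formula a statement
about Jacobian determinants only. -/
structure IsJacobianBump {n : ℕ} (η : EuclideanSpace ℝ (Fin n) → ℝ) (ε : ℝ) : Prop where
  continuous : Continuous η
  nonneg : ∀ y, 0 ≤ η y
  integral_eq_one : ∫ y, η y = 1
  support_subset : Function.support η ⊆ Metric.ball 0 ε
  exists_primitive : ∃ Φ : EuclideanSpace ℝ (Fin n) → EuclideanSpace ℝ (Fin n),
    ContDiff ℝ 1 Φ ∧ ∀ y, (fderiv ℝ Φ y).det = η y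

theorem norm_lt_of_forall_abs_lt {n : ℕ} {δ : ℝ} (hδ : 0 < δ) {y : EuclideanSpace ℝ (Fin n)}
    (h : ∀ i, |y i| < δ) : ‖y‖ < (n + 1) * δ := by
  have h1 : ‖y‖ ≤ n * δ := by
    refine abs_le_of_sq_le_sq' ?_ (by positivity) |>.2
    rw [EuclideanSpace.norm_sq_eq]
    calc ∑ i, ‖y i‖ ^ 2 ≤ ∑ _i : Fin n, δ ^ 2 := by
          refine Finset.sum_le_sum fun i _ => ?_
          have := (h i).le
          rw [Real.norm_eq_abs]
          gcongr
      _ = n * δ ^ 2 := by simp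
      _ ≤ (n * δ) ^ 2 := by
          rw [mul_pow]
          gcongr
          exact_mod_cast Nat.le_self_pow two_ne_zero n
  linarith

/-- The product of one-dimensional bumps in the coordinates is the Jacobian determinant of the map
whose components are the antiderivatives of these bumps. -/
theorem exists_isJacobianBump {n : ℕ} {ε : ℝ} (hε : 0 < ε) :
    ∃ η : EuclideanSpace ℝ (Fin n) → ℝ, IsJacobianBump η ε := by
  set δ : ℝ := ε / (n + 1)
  have hδ : 0 < δ := by positivity
  let b : ContDiffBump (0 : ℝ) := ⟨δ / 2, δ, by positivity, by linarith⟩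
  set β : ℝ → ℝ := b.normed volume
  have hβ : Continuous β := b.continuous_normed
  set B : ℝ → ℝ := fun x => ∫ t in (0 : ℝ)..x, β t
  have hB : ∀ x, HasDerivAt B (β x) x := fun x => (hβ.integral_hasStrictDerivAt 0 x).hasDerivAt
  have hB1 : ContDiff ℝ 1 B := by
    rw [contDiff_one_iff_deriv]
    refine ⟨fun x => (hB x).differentiableAt, ?_⟩
    rwa [show deriv B = β from funext fun x => (hB x).deriv]
  refine ⟨fun y => ∏ i, β (y i), ?_, ?_, ?_, ?_, ?_⟩
  · fun_prop
  · exact fun y => Finset.prod_nonneg fun i _ => b.nonneg_normed _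
  · rw [← (PiLp.volume_preserving_toLp (Fin n)).integral_comp
      (MeasurableEquiv.toLp 2 (Fin n → ℝ)).measurableEmbedding]
    refine (integral_fintype_prod_volume_eq_prod fun _ : Fin n => β).trans ?_
    refine Finset.prod_eq_one fun i _ => b.integral_normed
  · intro y hy
    rw [mem_ball_zero_iff]
    have h : ∀ i, |y i| < δ := by
      intro i
      have h1 : y i ∈ Function.support β := fun h0 =>
        hy (Finset.prod_eq_zero (Finset.mem_univ i) h0)
      rw [b.support_normed_eq, mem_ball_zero_iff] at h1
      exact h1
    refine (norm_lt_of_forall_abs_lt hδ h).trans_eq ?_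
    simp only [δ]; field_simp
  · refine ⟨fun y => WithLp.toLp 2 fun i => B (y i), ?_, fun y => ?_⟩
    · refine contDiff_piLp' _ fun i => ?_
      exact hB1.comp (contDiff_piLp_apply (p := 2))
    · have h : HasFDerivAt (fun y : EuclideanSpace ℝ (Fin n) =>
          (WithLp.toLp 2 fun i => B (y i) : EuclideanSpace ℝ (Fin n)))
          (Matrix.toEuclideanCLM (n := Fin n) (𝕜 := ℝ) (Matrix.diagonal fun i => β (y i))) y := by
        rw [← hasFDerivWithinAt_univ, hasFDerivWithinAt_piLp]
        intro i
        rw [hasFDerivWithinAt_univ]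
        have h1 := (hB (y i)).comp_hasFDerivAt y
          (PiLp.proj (𝕜 := ℝ) 2 (fun _ : Fin n => ℝ) i).hasFDerivAt
        refine h1.congr_fderiv ?_
        ext v
        simp [Matrix.ofLp_toEuclideanCLM, Matrix.mulVec_diagonal]
      rw [h.fderiv, ContinuousLinearMap.det, Matrix.coe_toEuclideanCLM_eq_toEuclideanLin]
      refine (congrArg LinearMap.det (LinearMap.congr_fun (congrArg LinearEquiv.toLinearMap
        (Matrix.toLpLin_eq_toLin (R := ℝ) (m := Fin n) 2 2)) _)).trans ?_
      exact (LinearMap.det_toLin _ _).trans Matrix.det_diagonal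

variable {n : ℕ} {η : EuclideanSpace ℝ (Fin n) → ℝ} {ε : ℝ}

theorem IsJacobianBump.tsupport_subset (h : IsJacobianBump η ε) :
    tsupport η ⊆ Metric.closedBall 0 ε :=
  (closure_mono h.support_subset).trans Metric.closure_ball_subset_closedBall

theorem IsJacobianBump.tsupport_translate_subset (h : IsJacobianBump η ε)
    (c : EuclideanSpace ℝ (Fin n)) : tsupport (fun y => η (y - c)) ⊆ Metric.closedBall c ε := by
  refine closure_minimal (fun y hy => ?_) Metric.isClosed_closedBall
  have := h.support_subset (show y - c ∈ Function.support η from hy)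
  rw [Metric.mem_closedBall, dist_eq_norm]
  exact (mem_ball_zero_iff.1 this).le

theorem IsJacobianBump.hasCompactSupport_translate (h : IsJacobianBump η ε)
    (c : EuclideanSpace ℝ (Fin n)) : HasCompactSupport fun y => η (y - c) :=
  (isCompact_closedBall c ε).of_isClosed_subset (isClosed_tsupport _)
    (h.tsupport_translate_subset c)

theorem IsJacobianBump.hasCompactSupport (h : IsJacobianBump η ε) : HasCompactSupport η :=
  (isCompact_closedBall 0 ε).of_isClosed_subset (isClosed_tsupport _) h.tsupport_subset

theorem IsJacobianBump.exists_primitive_translate (h : IsJacobianBump η ε)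
    (c : EuclideanSpace ℝ (Fin n)) : ∃ Φ : EuclideanSpace ℝ (Fin n) → EuclideanSpace ℝ (Fin n),
      ContDiff ℝ 1 Φ ∧ ∀ y, (fderiv ℝ Φ y).det = η (y - c) := by
  obtain ⟨Φ, hΦ, hd⟩ := h.exists_primitive
  refine ⟨fun y => Φ (y - c), hΦ.comp (contDiff_id.sub contDiff_const), fun y => ?_⟩
  simp only [sub_eq_add_neg]
  rw [fderiv_comp_add_right, hd]

end Bump

/-! ### The degree of a map over a domain that misses the image of the boundary -/

section Degree

variable {n : ℕ}

/-- The integral `∫_W f(g(x)) J_g(x) dx`, where `J_g = det g'`. -/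
noncomputable def pullbackIntegral (g : EuclideanSpace ℝ (Fin n) → EuclideanSpace ℝ (Fin n))
    (W : Set (EuclideanSpace ℝ (Fin n))) (f : EuclideanSpace ℝ (Fin n) → ℝ) : ℝ :=
  ∫ x in W, f (g x) * (fderiv ℝ g x).det

variable {g : EuclideanSpace ℝ (Fin n) → EuclideanSpace ℝ (Fin n)}
  {W : Set (EuclideanSpace ℝ (Fin n))} {f : EuclideanSpace ℝ (Fin n) → ℝ}

theorem integrableOn_comp_mul_det (hW : MeasurableSet W) (hg : ContinuousOn g W)
    (hJ : IntegrableOn (fun x => (fderiv ℝ g x).det) W) (hf : Continuous f)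
    (hfc : HasCompactSupport f) : IntegrableOn (fun x => f (g x) * (fderiv ℝ g x).det) W := by
  obtain ⟨C, hC⟩ := hf.bounded_above_of_compact_support hfc
  exact Integrable.bdd_mul hJ ((hf.comp_continuousOn hg).aestronglyMeasurable hW)
    (Eventually.of_forall fun x => hC (g x))

/-- Two integrals against the same kernel translated by `y₀` and by `y₁` agree, if the segment from
`y₀` to `y₁` is far from the image of the boundary. -/
theorem pullbackIntegral_translate_eq [NeZero n] (hW : IsOpen W) (hWb : Bornology.IsBounded W)
    (hg : ContDiffOn ℝ 1 g W) (hgc : ContinuousOn g (closure W))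
    (hJ : IntegrableOn (fun x => (fderiv ℝ g x).det) W) {η : EuclideanSpace ℝ (Fin n) → ℝ} {ε r : ℝ}
    (hη : IsJacobianBump η ε) {y₀ y₁ : EuclideanSpace ℝ (Fin n)}
    (hsep : ∀ x ∈ frontier W, g x ∉ Metric.ball y₀ r) (hr : dist y₁ y₀ + ε < r) :
    pullbackIntegral g W (fun y => η (y - y₁)) = pullbackIntegral g W (fun y => η (y - y₀)) := by
  obtain ⟨Φ, hΦ, hd⟩ := hη.exists_primitive_translate y₀
  have h := setIntegral_homotopy_eq_zero volume hW hWb hg hgc (v := fun _ => y₀ - y₁)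
    contDiffOn_const continuousOn_const hΦ (fun x hx t ht hmem => by
      simp only [hd] at hmem
      have h1 := hη.tsupport_translate_subset y₀ hmem
      refine hsep x hx ?_
      rw [Metric.mem_closedBall, dist_eq_norm] at h1
      rw [Metric.mem_ball, dist_eq_norm]
      calc ‖g x - y₀‖ = ‖(g x + t • (y₀ - y₁) - y₀) + t • (y₁ - y₀)‖ := by
            congr 1; module
        _ ≤ ‖g x + t • (y₀ - y₁) - y₀‖ + ‖t • (y₁ - y₀)‖ := norm_add_le _ _
        _ ≤ ε + dist y₁ y₀ := by
            rw [norm_smul, Real.norm_of_nonneg ht.1, dist_eq_norm]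
            gcongr
            exact mul_le_of_le_one_left (norm_nonneg _) ht.2
        _ < r := by linarith)
  simp only [hd, fderiv_add_const] at h
  have hi : ∀ c, IntegrableOn (fun x => η (g x - c) * (fderiv ℝ g x).det) W := fun c =>
    integrableOn_comp_mul_det (f := fun y => η (y - c)) hW.measurableSet
      (hgc.mono subset_closure) hJ (hη.continuous.comp (by fun_prop))
      (hη.hasCompactSupport_translate c)
  have he : ∀ x, g x + (y₀ - y₁) - y₀ = g x - y₁ := fun x => by abel
  simp only [he] at h
  rw [integral_sub (hi y₁) (hi y₀)] at h
  exact sub_eq_zero.1 h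

/-- The integrals against translates of a kernel by points of a compact subset of `D` all agree as
soon as the support of the kernel is small. -/
theorem exists_pullbackIntegral_translate_eq_of_isCompact [NeZero n] (hW : IsOpen W)
    (hWb : Bornology.IsBounded W) (hg : ContDiffOn ℝ 1 g W) (hgc : ContinuousOn g (closure W))
    (hJ : IntegrableOn (fun x => (fderiv ℝ g x).det) W) {η : ℕ → EuclideanSpace ℝ (Fin n) → ℝ}
    {ε : ℕ → ℝ} (hη : ∀ j, IsJacobianBump (η j) (ε j)) (hε : Tendsto ε atTop (𝓝 0))
    {D : Set (EuclideanSpace ℝ (Fin n))} (hD : IsOpen D) (hDc : IsConnected D)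
    (hsep : ∀ x ∈ frontier W, g x ∉ D) :
    ∃ k : ℕ → ℝ, ∀ C ⊆ D, IsCompact C → ∀ᶠ j in atTop, ∀ z ∈ C,
      pullbackIntegral g W (fun y => η j (y - z)) = k j := by
  set A : ℕ → EuclideanSpace ℝ (Fin n) → ℝ := fun j z => pullbackIntegral g W (fun y => η j (y - z))
  -- the integrals over translates are locally constant, uniformly in the kernel
  have hloc : ∀ y ∈ D, ∃ r > 0, ∀ᶠ j in atTop, ∀ z ∈ Metric.ball y r, A j z = A j y := by
    intro y hy
    obtain ⟨r, hr, hrD⟩ := Metric.isOpen_iff.1 hD y hy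
    refine ⟨r / 2, by positivity, ?_⟩
    filter_upwards [hε.eventually_lt_const (show (0 : ℝ) < r / 2 by positivity)] with j hj z hz
    refine pullbackIntegral_translate_eq hW hWb hg hgc hJ (hη j)
      (fun x hx h => hsep x hx (hrD h)) ?_
    rw [Metric.mem_ball] at hz
    linarith
  obtain ⟨⟨y₀, hy₀⟩, hpre⟩ := hDc
  set S : Set (EuclideanSpace ℝ (Fin n)) :=
    {y | ∃ r > 0, ∀ᶠ j in atTop, ∀ z ∈ Metric.ball y r, A j z = A j y₀}
  have hSo : IsOpen S := by
    refine Metric.isOpen_iff.2 fun y ⟨r, hr, h⟩ => ⟨r, hr, fun w hw => ?_⟩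
    refine ⟨r - dist w y, sub_pos.2 hw, h.mono fun j hj z hz => hj z ?_⟩
    rw [Metric.mem_ball] at hz ⊢
    linarith [dist_triangle z w y]
  have hDS : D ⊆ S := by
    refine hpre.subset_of_closure_inter_subset hSo ⟨y₀, hy₀, hloc y₀ hy₀⟩ ?_
    rintro y ⟨hyS, hyD⟩
    obtain ⟨r, hr, h⟩ := hloc y hyD
    obtain ⟨w, ⟨r', hr', hw⟩, hwy⟩ := Metric.mem_closure_iff.1 hyS r hr
    refine ⟨r, hr, ?_⟩
    filter_upwards [h, hw] with j hj hj' z hz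
    rw [hj z hz, ← hj w (by rwa [Metric.mem_ball, dist_comm]), hj' w (Metric.mem_ball_self hr')]
  refine ⟨fun j => A j y₀, fun C hCD hC => ?_⟩
  refine hC.induction_on (p := fun s => ∀ᶠ j in atTop, ∀ z ∈ s, A j z = A j y₀) (by simp)
    (fun s t hst h => h.mono fun j hj z hz => hj z (hst hz))
    (fun s t hs ht => by
      filter_upwards [hs, ht] with j hj hj' z hz
      exact hz.elim (hj z) (hj' z)) fun y hy => ?_
  obtain ⟨r, hr, h⟩ := hDS (hCD hy)
  exact ⟨_, mem_nhdsWithin_of_mem_nhds (Metric.ball_mem_nhds y hr), h⟩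

/-- Averaging the integrals against translates of `η` with weight `f` amounts to the integral
against the convolution of `f` with `η`. -/
theorem pullbackIntegral_convolution (hW : IsOpen W) (hgc : ContinuousOn g W)
    (hJ : IntegrableOn (fun x => (fderiv ℝ g x).det) W) {η : EuclideanSpace ℝ (Fin n) → ℝ} {ε : ℝ}
    (hη : IsJacobianBump η ε) (hf : Continuous f) (hfc : HasCompactSupport f) :
    ∫ z, f z * pullbackIntegral g W (fun y => η (y - z)) =
      ∫ x in W, (∫ z, η (g x - z) * f z) * (fderiv ℝ g x).det := by
  obtain ⟨C, hC⟩ := hη.continuous.bounded_above_of_compact_support hη.hasCompactSupport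
  have hgm : AEStronglyMeasurable g (volume.restrict W) :=
    hgc.aestronglyMeasurable hW.measurableSet
  have hint : Integrable (Function.uncurry fun z x =>
      η (g x - z) * (f z * (fderiv ℝ g x).det)) (volume.prod (volume.restrict W)) := by
    refine Integrable.bdd_mul ((hf.integrable_of_hasCompactSupport hfc).mul_prod hJ) ?_
      (Eventually.of_forall fun p => hC _)
    exact hη.continuous.comp_aestronglyMeasurable
      ((hgm.comp_snd (μ := volume)).sub continuous_fst.aestronglyMeasurable)
  have h1 := integral_integral_swap hint
  calc ∫ z, f z * pullbackIntegral g W (fun y => η (y - z))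
      = ∫ z, ∫ x in W, η (g x - z) * (f z * (fderiv ℝ g x).det) := by
        refine integral_congr_ae (Eventually.of_forall fun z => ?_)
        simp only [pullbackIntegral]
        rw [← integral_const_mul]
        refine integral_congr_ae (Eventually.of_forall fun x => ?_)
        simp only; ring
    _ = ∫ x in W, ∫ z, η (g x - z) * (f z * (fderiv ℝ g x).det) := h1
    _ = _ := by
        refine integral_congr_ae (Eventually.of_forall fun x => ?_)
        simp only [← mul_assoc]
        rw [integral_mul_const]

theorem tendsto_integral_mul_pullbackIntegral_translate (hW : IsOpen W) (hgc : ContinuousOn g W)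
    (hJ : IntegrableOn (fun x => (fderiv ℝ g x).det) W) {η : ℕ → EuclideanSpace ℝ (Fin n) → ℝ}
    {ε : ℕ → ℝ} (hη : ∀ j, IsJacobianBump (η j) (ε j)) (hε : Tendsto ε atTop (𝓝 0))
    (hf : Continuous f) (hfc : HasCompactSupport f) :
    Tendsto (fun j => ∫ z, f z * pullbackIntegral g W (fun y => η j (y - z))) atTop
      (𝓝 (pullbackIntegral g W f)) := by
  obtain ⟨C, hC⟩ := hf.bounded_above_of_compact_support hfc
  simp only [pullbackIntegral_convolution hW hgc hJ (hη _) hf hfc]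
  have hconv : ∀ j y, ∫ z, η j (y - z) * f z =
      (MeasureTheory.convolution (η j) f (ContinuousLinearMap.lsmul ℝ ℝ) volume) y := by
    intro j y
    rw [convolution_eq_swap]
    simp
  have hcc : ∀ j, Continuous fun y => ∫ z, η j (y - z) * f z := by
    intro j
    simp only [hconv]
    exact hfc.continuous_convolution_right _
      ((hη j).continuous.integrable_of_hasCompactSupport (hη j).hasCompactSupport).locallyIntegrable
      hf
  have hsupp : Tendsto (fun j => Function.support (η j)) atTop
      (𝓝 (0 : EuclideanSpace ℝ (Fin n))).smallSets := by
    rw [tendsto_smallSets_iff]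
    intro t ht
    obtain ⟨r, hr, hrt⟩ := Metric.mem_nhds_iff.1 ht
    filter_upwards [hε.eventually_lt_const hr] with j hj
    exact (hη j).support_subset.trans ((Metric.ball_subset_ball hj.le).trans hrt)
  refine tendsto_integral_of_dominated_convergence (fun x => C * ‖(fderiv ℝ g x).det‖)
    (fun j => ?_) (hJ.norm.const_mul C) (fun j => Eventually.of_forall fun x => ?_)
    (Eventually.of_forall fun x => ?_)
  · exact (((hcc j).comp_continuousOn hgc).aestronglyMeasurable hW.measurableSet).mul
      hJ.aestronglyMeasurable
  · rw [norm_mul]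
    gcongr
    have hi : Integrable fun z => η j (g x - z) :=
      (((hη j).continuous.integrable_of_hasCompactSupport (hη j).hasCompactSupport)).comp_sub_left _
    calc ‖∫ z, η j (g x - z) * f z‖ ≤ ∫ z, η j (g x - z) * C := by
          refine norm_integral_le_of_norm_le (hi.mul_const C) (Eventually.of_forall fun z => ?_)
          rw [norm_mul, Real.norm_of_nonneg ((hη j).nonneg _)]
          exact mul_le_mul_of_nonneg_left (hC z) ((hη j).nonneg _)
      _ = C := by
          rw [integral_mul_const, integral_sub_left_eq_self (η j) volume, (hη j).integral_eq_one,
            one_mul]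
  · refine Tendsto.mul_const _ ?_
    simp only [hconv]
    exact convolution_tendsto_right (Eventually.of_forall fun j => (hη j).nonneg)
      (Eventually.of_forall fun j => (hη j).integral_eq_one) hsupp
      (Eventually.of_forall fun _ => hf.aestronglyMeasurable)
      ((hf.tendsto _).comp tendsto_snd) tendsto_const_nhds

/-- The degree: on a connected open set `D` that misses the image of the boundary of `W`, the
functional `f ↦ ∫_W (f ∘ g) J_g` is a constant multiple of the integral. -/
theorem exists_degree [NeZero n] (hW : IsOpen W) (hWb : Bornology.IsBounded W)
    (hg : ContDiffOn ℝ 1 g W) (hgc : ContinuousOn g (closure W))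
    (hJ : IntegrableOn (fun x => (fderiv ℝ g x).det) W)
    {D : Set (EuclideanSpace ℝ (Fin n))} (hD : IsOpen D) (hDc : IsConnected D)
    (hsep : ∀ x ∈ frontier W, g x ∉ D) :
    ∃ k : ℝ, ∀ f : EuclideanSpace ℝ (Fin n) → ℝ, Continuous f → HasCompactSupport f →
      tsupport f ⊆ D → pullbackIntegral g W f = k * ∫ y, f y := by
  have hε : ∀ j : ℕ, (0 : ℝ) < 1 / (j + 1) := fun j => by positivity
  choose η hη using fun j => exists_isJacobianBump (n := n) (hε j)
  have hε0 : Tendsto (fun j : ℕ => (1 : ℝ) / (j + 1)) atTop (𝓝 0) :=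
    tendsto_one_div_add_atTop_nhds_zero_nat
  obtain ⟨κ, hκ⟩ := exists_pullbackIntegral_translate_eq_of_isCompact hW hWb hg hgc hJ hη hε0 hD hDc
    hsep
  have hlim : ∀ f : EuclideanSpace ℝ (Fin n) → ℝ, Continuous f → HasCompactSupport f →
      tsupport f ⊆ D → Tendsto (fun j => κ j * ∫ y, f y) atTop (𝓝 (pullbackIntegral g W f)) := by
    intro f hf hfc hfD
    refine (tendsto_integral_mul_pullbackIntegral_translate hW (hgc.mono subset_closure) hJ hη hε0
      hf hfc).congr' ?_
    filter_upwards [hκ _ hfD hfc] with j hj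
    rw [← integral_const_mul]
    refine integral_congr_ae (Eventually.of_forall fun z => ?_)
    by_cases hz : z ∈ tsupport f
    · simp only [hj z hz, mul_comm]
    · simp only [image_eq_zero_of_notMem_tsupport hz, zero_mul, mul_zero]
  obtain ⟨y₀, hy₀⟩ := hDc.1
  obtain ⟨r, hr, hrD⟩ := Metric.isOpen_iff.1 hD y₀ hy₀
  obtain ⟨η₀, hη₀⟩ := exists_isJacobianBump (n := n) (half_pos hr)
  have h0 := hlim (fun y => η₀ (y - y₀)) (hη₀.continuous.comp (by fun_prop))
    (hη₀.hasCompactSupport_translate y₀) ((hη₀.tsupport_translate_subset y₀).trans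
      ((Metric.closedBall_subset_ball (half_lt_self hr)).trans hrD))
  rw [integral_sub_right_eq_self η₀ y₀, hη₀.integral_eq_one] at h0
  simp only [mul_one] at h0
  exact ⟨_, fun f hf hfc hfD => tendsto_nhds_unique (hlim f hf hfc hfD) (h0.mul_const _)⟩

end Degree

/-! ### Domains with `C¹` boundary near a boundary point -/

section Boundary

variable {n : ℕ} {Ω : Set (EuclideanSpace ℝ (Fin n))} {p : EuclideanSpace ℝ (Fin n)}
  {ρ : EuclideanSpace ℝ (Fin n) → ℝ}

theorem inner_gradient_eq_fderiv (ρ : EuclideanSpace ℝ (Fin n) → ℝ)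
    (p v : EuclideanSpace ℝ (Fin n)) :
    inner ℝ (gradient ρ p) v = fderiv ℝ ρ p v := by
  rw [gradient, InnerProductSpace.toDual_symm_apply]

namespace IsLocalDefiningFunction

/-- Near `p` a local defining function is uniformly close to its linear part. -/
theorem exists_ball (h : IsLocalDefiningFunction Ω p ρ) {δ : ℝ} (hδ : 0 < δ) :
    ∃ r > 0, ∀ x ∈ Metric.ball p r, (x ∈ Ω ↔ ρ x < 0) ∧ ContinuousAt ρ x ∧
      ∀ y ∈ Metric.ball p r,
        |ρ x - ρ y - inner ℝ (gradient ρ p) (x - y)| ≤ δ * ‖x - y‖ := by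
  have h1 := (h.contDiffAt.hasStrictFDerivAt one_ne_zero).isLittleO.def hδ
  rw [nhds_prod_eq] at h1
  obtain ⟨s, hs, hsb⟩ := mem_prod_self_iff.1 h1
  have h2 : ∀ᶠ x in 𝓝 p, ContinuousAt ρ x :=
    (h.contDiffAt.eventually (by simp)).mono fun x hx => hx.continuousAt
  obtain ⟨r, hr, hball⟩ := Metric.mem_nhds_iff.1 (inter_mem hs (inter_mem h.mem_iff h2))
  refine ⟨r, hr, fun x hx => ⟨(hball hx).2.1, (hball hx).2.2, fun y hy => ?_⟩⟩
  rw [inner_gradient_eq_fderiv]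
  exact hsb (mk_mem_prod (hball hx).1 (hball hy).1)

theorem eventually_pos_notMem_closure (h : IsLocalDefiningFunction Ω p ρ) :
    ∀ᶠ x in 𝓝 p, 0 < ρ x → x ∉ closure Ω := by
  have h2 : ∀ᶠ x in 𝓝 p, ContinuousAt ρ x :=
    (h.contDiffAt.eventually (by simp)).mono fun x hx => hx.continuousAt
  filter_upwards [h.mem_iff.eventually_nhds, h2] with x hx hxc hpos hmem
  rw [mem_closure_iff_frequently] at hmem
  obtain ⟨y, hy, hy1, hy2⟩ := (hmem.and_eventually (hx.and (hxc.eventually_const_lt hpos))).exists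
  exact absurd (hy1.1 hy) (not_lt.2 hy2.le)

theorem hasDerivAt_comp_add_smul (h : IsLocalDefiningFunction Ω p ρ)
    (v : EuclideanSpace ℝ (Fin n)) :
    HasDerivAt (fun t : ℝ => ρ (p + t • v)) (inner ℝ (gradient ρ p) v) 0 := by
  have h0 : HasDerivAt (fun t : ℝ => p + t • v) v 0 := by
    simpa using ((hasDerivAt_id (0 : ℝ)).smul_const v).const_add p
  have h2 : HasFDerivAt ρ (fderiv ℝ ρ p) (p + (0 : ℝ) • v) := by
    simpa using (h.contDiffAt.differentiableAt one_ne_zero).hasFDerivAt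
  rw [inner_gradient_eq_fderiv]
  exact h2.comp_hasDerivAt (0 : ℝ) h0

theorem eventually_pos_of_inner_pos (h : IsLocalDefiningFunction Ω p ρ)
    {v : EuclideanSpace ℝ (Fin n)} (hv : 0 < inner ℝ (gradient ρ p) v) :
    ∀ᶠ t in 𝓝[>] (0 : ℝ), 0 < ρ (p + t • v) := by
  have h3 := eventually_nhdsWithin_sign_eq_of_deriv_pos (f := fun t : ℝ => ρ (p + t • v)) (x₀ := 0)
    (by rwa [(h.hasDerivAt_comp_add_smul v).deriv]) (by simp [h.eq_zero])
  filter_upwards [h3.filter_mono nhdsWithin_le_nhds, self_mem_nhdsWithin] with t ht ht0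
  rw [sub_zero, sign_pos (show (0 : ℝ) < t from ht0), sign_eq_one_iff] at ht
  exact ht

theorem eventually_neg_of_inner_neg (h : IsLocalDefiningFunction Ω p ρ)
    {v : EuclideanSpace ℝ (Fin n)} (hv : inner ℝ (gradient ρ p) v < 0) :
    ∀ᶠ t in 𝓝[>] (0 : ℝ), ρ (p + t • v) < 0 := by
  have h3 := eventually_nhdsWithin_sign_eq_of_deriv_neg (f := fun t : ℝ => ρ (p + t • v)) (x₀ := 0)
    (by rwa [(h.hasDerivAt_comp_add_smul v).deriv]) (by simp [h.eq_zero])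
  filter_upwards [h3.filter_mono nhdsWithin_le_nhds, self_mem_nhdsWithin] with t ht ht0
  have ht0' : (0 : ℝ) < t := ht0
  rw [zero_sub, sign_neg (neg_lt_zero.2 ht0'), sign_eq_neg_one_iff] at ht
  exact ht

theorem neg_gradient_inner_neg (h : IsLocalDefiningFunction Ω p ρ) :
    inner ℝ (gradient ρ p) (-gradient ρ p) < 0 := by
  rw [inner_neg_right, neg_lt_zero]
  exact real_inner_self_pos.2 h.gradient_ne_zero

theorem tendsto_add_smul (p v : EuclideanSpace ℝ (Fin n)) :
    Tendsto (fun t : ℝ => p + t • v) (𝓝[>] 0) (𝓝 p) := by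
  have hcont : ContinuousAt (fun t : ℝ => p + t • v) 0 := by fun_prop
  have := hcont.tendsto
  simp only [zero_smul, add_zero] at this
  exact this.mono_left nhdsWithin_le_nhds

theorem eventually_mem (h : IsLocalDefiningFunction Ω p ρ)
    {v : EuclideanSpace ℝ (Fin n)} (hv : inner ℝ (gradient ρ p) v < 0) :
    ∀ᶠ t in 𝓝[>] (0 : ℝ), p + t • v ∈ Ω := by
  filter_upwards [h.eventually_neg_of_inner_neg hv, (tendsto_add_smul p v).eventually h.mem_iff]
    with t ht h1 using h1.2 ht

theorem notMem (h : IsLocalDefiningFunction Ω p ρ) : p ∉ Ω := fun hp =>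
  (h.mem_iff.self_of_nhds.1 hp).ne h.eq_zero

theorem mem_closure (h : IsLocalDefiningFunction Ω p ρ) : p ∈ closure Ω :=
  mem_closure_of_tendsto (tendsto_add_smul p _) (h.eventually_mem h.neg_gradient_inner_neg)

/-- No openness of `Ω` is needed here: `p` is not in `Ω` because `Ω` is `{ρ < 0}` near `p`. -/
theorem mem_frontier (h : IsLocalDefiningFunction Ω p ρ) : p ∈ frontier Ω :=
  ⟨h.mem_closure, fun hp => h.notMem (interior_subset hp)⟩

/-- A local defining function also defines the set at the nearby zeros of the function. -/
theorem eventually_isLocalDefiningFunction (h : IsLocalDefiningFunction Ω p ρ) :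
    ∀ᶠ x in 𝓝 p, ρ x = 0 → IsLocalDefiningFunction Ω x ρ := by
  have h1 : ContinuousAt (gradient ρ) p :=
    (InnerProductSpace.toDual ℝ _).symm.continuous.continuousAt.comp
      (h.contDiffAt.continuousAt_fderiv one_ne_zero)
  filter_upwards [h.contDiffAt.eventually (by simp), h.mem_iff.eventually_nhds,
    h1.eventually_ne h.gradient_ne_zero] with x hx1 hx2 hx3 hx0
  exact ⟨hx1, hx0, hx3, hx2⟩

theorem eventually_eq_zero_of_mem_frontier (h : IsLocalDefiningFunction Ω p ρ) (hΩ : IsOpen Ω) :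
    ∀ᶠ x in 𝓝 p, x ∈ frontier Ω → ρ x = 0 := by
  filter_upwards [h.eventually_pos_notMem_closure, h.mem_iff] with x hx1 hx2 hx
  refine le_antisymm (not_lt.1 fun hpos => hx1 hpos hx.1) (not_lt.1 fun hneg => ?_)
  exact hx.2 (hΩ.interior_eq.symm ▸ hx2.2 hneg)

theorem eventually_of_mem_frontier (h : IsLocalDefiningFunction Ω p ρ) (hΩ : IsOpen Ω) :
    ∀ᶠ x in 𝓝 p, x ∈ frontier Ω → IsLocalDefiningFunction Ω x ρ := by
  filter_upwards [h.eventually_isLocalDefiningFunction, h.eventually_eq_zero_of_mem_frontier hΩ]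
    with x hx1 hx2 hx using hx1 (hx2 hx)

theorem eventually_mem_frontier (h : IsLocalDefiningFunction Ω p ρ) :
    ∀ᶠ x in 𝓝 p, ρ x = 0 → x ∈ frontier Ω :=
  h.eventually_isLocalDefiningFunction.mono fun _ hx h0 => (hx h0).mem_frontier

theorem isUnitOuterNormal (h : IsLocalDefiningFunction Ω p ρ) :
    IsUnitOuterNormal Ω p (‖gradient ρ p‖⁻¹ • gradient ρ p) := ⟨ρ, h, rfl⟩

theorem eventually_notMem_closure (h : IsLocalDefiningFunction Ω p ρ)
    {v : EuclideanSpace ℝ (Fin n)} (hv : 0 < inner ℝ (gradient ρ p) v) :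
    ∀ᶠ t in 𝓝[>] (0 : ℝ), p + t • v ∉ closure Ω := by
  filter_upwards [h.eventually_pos_of_inner_pos hv,
    (tendsto_add_smul p v).eventually h.eventually_pos_notMem_closure] with t ht1 ht2 using ht2 ht1

theorem frequently_notMem_closure (h : IsLocalDefiningFunction Ω p ρ) :
    ∃ᶠ x in 𝓝 p, x ∉ closure Ω :=
  (tendsto_add_smul p (gradient ρ p)).frequently
    (h.eventually_notMem_closure (real_inner_self_pos.2 h.gradient_ne_zero)).frequently

/-- The tangent cone of the boundary contains the hyperplane orthogonal to the gradient: by the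
intermediate value theorem the line through `p + t τ` along the gradient meets the boundary at
distance `o(t)`. -/
theorem mem_tangentConeAt_frontier (h : IsLocalDefiningFunction Ω p ρ)
    {τ : EuclideanSpace ℝ (Fin n)} (hτ : inner ℝ (gradient ρ p) τ = 0) :
    τ ∈ tangentConeAt ℝ (frontier Ω) p := by
  set a := gradient ρ p
  have ha : 0 < ‖a‖ := norm_pos_iff.2 h.gradient_ne_zero
  have key : ∀ j : ℕ, ∃ t s : ℝ, 0 < t ∧ t ≤ 1 / (j + 1) ∧ |s| ≤ t * (1 / (j + 1)) ∧
      p + (t • τ + s • a) ∈ frontier Ω := by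
    intro j
    set e : ℝ := 1 / (j + 1)
    have he : 0 < e := by positivity
    set M : ℝ := ‖τ‖ + e * ‖a‖
    have hM : 0 < M := by positivity
    obtain ⟨r₁, hr₁, hb⟩ := h.exists_ball (δ := e * ‖a‖ ^ 2 / M) (by positivity)
    obtain ⟨r₂, hr₂, hf⟩ := Metric.eventually_nhds_iff_ball.1 h.eventually_mem_frontier
    set r := min r₁ r₂
    have hr : 0 < r := lt_min hr₁ hr₂
    set t := min e (r / (2 * M))
    have ht : 0 < t := lt_min he (by positivity)
    have hball : ∀ s ∈ Icc (-(t * e)) (t * e), p + (t • τ + s • a) ∈ Metric.ball p r ∧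
        ‖t • τ + s • a‖ ≤ t * M := by
      intro s hs
      have h1 : ‖t • τ + s • a‖ ≤ t * M := by
        refine (norm_add_le _ _).trans ?_
        rw [norm_smul, norm_smul, Real.norm_of_nonneg ht.le, Real.norm_eq_abs]
        have := abs_le.2 hs
        calc t * ‖τ‖ + |s| * ‖a‖ ≤ t * ‖τ‖ + t * e * ‖a‖ := by gcongr
          _ = t * M := by simp only [M]; ring
      refine ⟨?_, h1⟩
      rw [Metric.mem_ball, dist_eq_norm, add_sub_cancel_left]
      have h2 : t * M ≤ r / 2 := by
        calc t * M ≤ r / (2 * M) * M := by gcongr; exact min_le_right _ _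
          _ = r / 2 := by field_simp
      linarith
    have hest : ∀ s ∈ Icc (-(t * e)) (t * e),
        |ρ (p + (t • τ + s • a)) - s * ‖a‖ ^ 2| ≤ t * e * ‖a‖ ^ 2 := by
      intro s hs
      obtain ⟨h1, h2⟩ := hball s hs
      have h3 := (hb _ (Metric.ball_subset_ball (min_le_left _ _) h1)).2.2 p
        (Metric.mem_ball_self hr₁)
      rw [h.eq_zero, sub_zero, add_sub_cancel_left, inner_add_right, inner_smul_right,
        inner_smul_right, hτ, mul_zero, zero_add, real_inner_self_eq_norm_sq] at h3
      refine h3.trans ?_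
      calc e * ‖a‖ ^ 2 / M * ‖t • τ + s • a‖ ≤ e * ‖a‖ ^ 2 / M * (t * M) := by gcongr
        _ = t * e * ‖a‖ ^ 2 := by field_simp
    have hte : 0 ≤ t * e := by positivity
    have hcont : ContinuousOn (fun s : ℝ => ρ (p + (t • τ + s • a))) (Icc (-(t * e)) (t * e)) := by
      intro s hs
      have h1 : ContinuousAt ρ (p + (t • τ + s • a)) :=
        (hb _ (Metric.ball_subset_ball (min_le_left _ _) (hball s hs).1)).2.1
      exact (ContinuousAt.comp (f := fun s : ℝ => p + (t • τ + s • a)) h1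
        (by fun_prop)).continuousWithinAt
    have h0 : (0 : ℝ) ∈ Icc (ρ (p + (t • τ + (-(t * e)) • a))) (ρ (p + (t • τ + (t * e) • a))) := by
      have e1 := (abs_le.1 (hest _ ⟨le_rfl, by linarith⟩)).2
      have e2 := (abs_le.1 (hest _ ⟨by linarith, le_rfl⟩)).1
      exact ⟨by linarith, by linarith⟩
    obtain ⟨s, hs, hs0⟩ := intermediate_value_Icc (by linarith) hcont h0
    exact ⟨t, s, ht, min_le_left _ _, abs_le.2 hs,
      hf _ (Metric.ball_subset_ball (min_le_right _ _) (hball s hs).1) hs0⟩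
  choose t s ht0 ht hs hmem using key
  have hlim : Tendsto (fun j : ℕ => (1 : ℝ) / (j + 1)) atTop (𝓝 0) :=
    tendsto_one_div_add_atTop_nhds_zero_nat
  have ht_lim : Tendsto t atTop (𝓝 0) := squeeze_zero (fun j => (ht0 j).le) ht hlim
  have hst : Tendsto (fun j => s j / t j) atTop (𝓝 0) := by
    refine squeeze_zero_norm (fun j => ?_) hlim
    rw [norm_div, Real.norm_eq_abs, Real.norm_of_nonneg (ht0 j).le, div_le_iff₀ (ht0 j), mul_comm]
    exact hs j
  have hs_lim : Tendsto s atTop (𝓝 0) := by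
    have := hst.mul ht_lim
    simp only [mul_zero] at this
    exact this.congr fun j => div_mul_cancel₀ _ (ht0 j).ne'
  refine mem_tangentConeAt_of_seq atTop (fun j => (t j)⁻¹) (fun j => t j • τ + s j • a) ?_
    (Eventually.of_forall hmem) ?_
  · simpa using (ht_lim.smul_const τ).add (hs_lim.smul_const a)
  · have := (hst.smul_const a).const_add τ
    simp only [zero_smul, add_zero] at this
    refine this.congr fun j => ?_
    rw [smul_add, inv_smul_smul₀ (ht0 j).ne', smul_smul, div_eq_inv_mul]

theorem inner_gradient_eq_zero_of_mem_tangentConeAt (h : IsLocalDefiningFunction Ω p ρ)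
    (hΩ : IsOpen Ω) {τ : EuclideanSpace ℝ (Fin n)} (hτ : τ ∈ tangentConeAt ℝ (frontier Ω) p) :
    inner ℝ (gradient ρ p) τ = 0 := by
  have h1 : HasFDerivWithinAt ρ (fderiv ℝ ρ p) (frontier Ω) p :=
    (h.contDiffAt.differentiableAt one_ne_zero).hasFDerivAt.hasFDerivWithinAt
  have h2 : HasFDerivWithinAt ρ (0 : EuclideanSpace ℝ (Fin n) →L[ℝ] ℝ) (frontier Ω) p := by
    refine (hasFDerivWithinAt_const (0 : ℝ) p (frontier Ω)).congr_of_eventuallyEq ?_ h.eq_zero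
    rw [Filter.EventuallyEq, eventually_nhdsWithin_iff]
    exact h.eventually_eq_zero_of_mem_frontier hΩ
  rw [inner_gradient_eq_fderiv]
  exact h1.unique_on h2 hτ

theorem uniqueDiffWithinAt_closure (h : IsLocalDefiningFunction Ω p ρ) :
    UniqueDiffWithinAt ℝ (closure Ω) p := by
  refine ⟨?_, subset_closure h.mem_closure⟩
  set H : Set (EuclideanSpace ℝ (Fin n)) := {v | inner ℝ (gradient ρ p) v < 0}
  have hH : IsOpen H := isOpen_lt (by fun_prop) continuous_const
  have hHt : H ⊆ tangentConeAt ℝ (closure Ω) p := by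
    intro v hv
    obtain ⟨u, -, hu0, hu⟩ := exists_seq_strictAnti_tendsto (0 : ℝ)
    have hu' : Tendsto u atTop (𝓝[>] 0) :=
      tendsto_nhdsWithin_iff.2 ⟨hu, Eventually.of_forall hu0⟩
    refine mem_tangentConeAt_of_seq atTop (fun j => (u j)⁻¹) (fun j => u j • v) ?_ ?_ ?_
    · simpa using hu.smul_const v
    · exact (hu'.eventually (h.eventually_mem hv)).mono fun j hj => subset_closure hj
    · refine tendsto_const_nhds.congr fun j => ?_
      rw [inv_smul_smul₀ (hu0 j).ne']
  have htop : Submodule.span ℝ (tangentConeAt ℝ (closure Ω) p) = ⊤ := by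
    apply Submodule.eq_top_of_nonempty_interior'
    refine ⟨-gradient ρ p, interior_mono (hHt.trans Submodule.subset_span) ?_⟩
    rw [hH.interior_eq]
    exact h.neg_gradient_inner_neg
  rw [htop]
  exact dense_univ

/-- Local quasi-convexity of `Ω` at a boundary point: two nearby points are joined in `Ω` by a path
of three segments (inwards, across, outwards) of total length at most `7` times their distance. -/
theorem exists_ball_segment_subset (h : IsLocalDefiningFunction Ω p ρ) {R : ℝ} (hR : 0 < R) :
    ∃ r > 0, ∀ x ∈ Ω ∩ Metric.ball p r, ∀ y ∈ Ω ∩ Metric.ball p r,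
      ∃ u v : EuclideanSpace ℝ (Fin n), segment ℝ x u ⊆ Ω ∩ Metric.ball p R ∧
        segment ℝ u v ⊆ Ω ∩ Metric.ball p R ∧ segment ℝ v y ⊆ Ω ∩ Metric.ball p R ∧
        ‖u - x‖ + ‖v - u‖ + ‖y - v‖ ≤ 7 * ‖y - x‖ := by
  set a := gradient ρ p
  have ha : 0 < ‖a‖ := norm_pos_iff.2 h.gradient_ne_zero
  obtain ⟨r₁, hr₁, hb⟩ := h.exists_ball (δ := ‖a‖ / 2) (by positivity)
  set R' := min r₁ R
  have hR' : 0 < R' := lt_min hr₁ hR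
  refine ⟨R' / 10, by positivity, fun x hx y hy => ?_⟩
  have hxp : ‖x - p‖ < R' / 10 := by simpa [dist_eq_norm] using hx.2
  have hyp : ‖y - p‖ < R' / 10 := by simpa [dist_eq_norm] using hy.2
  have hxy : ‖y - x‖ < R' / 5 := by
    have : y - x = (y - p) - (x - p) := by abel
    rw [this]
    linarith [norm_sub_le (y - p) (x - p)]
  set l : ℝ := 3 * ‖y - x‖ / ‖a‖
  have hl : 0 ≤ l := by positivity
  have hla : l * ‖a‖ = 3 * ‖y - x‖ := by simp only [l]; field_simp
  -- moving from a point of `Ω` by `-s a + w` decreases `ρ` if `‖w‖` is small compared to `s`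
  have hmove : ∀ z ∈ Ω ∩ Metric.ball p (R' / 10), ∀ (s : ℝ) (w : EuclideanSpace ℝ (Fin n)), 0 ≤ s →
      s ≤ l → ‖w‖ ≤ ‖y - x‖ → 3 * ‖w‖ ≤ s * ‖a‖ → z + (-(s • a) + w) ∈ Ω ∩ Metric.ball p R := by
    intro z hz s w hs hsl hw hws
    have hzp : ‖z - p‖ < R' / 10 := by simpa [dist_eq_norm] using hz.2
    have hzR : z ∈ Metric.ball p r₁ := by
      rw [Metric.mem_ball, dist_eq_norm]
      linarith [min_le_left r₁ R]
    have hnorm : ‖-(s • a) + w‖ ≤ s * ‖a‖ + ‖w‖ := by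
      refine (norm_add_le _ _).trans ?_
      rw [norm_neg, norm_smul, Real.norm_of_nonneg hs]
    have hsa : s * ‖a‖ ≤ 3 * ‖y - x‖ := by rw [← hla]; gcongr
    have hin : ‖z + (-(s • a) + w) - p‖ < R' := by
      have : z + (-(s • a) + w) - p = (z - p) + (-(s • a) + w) := by abel
      rw [this]
      linarith [norm_add_le (z - p) (-(s • a) + w)]
    have hin₁ : z + (-(s • a) + w) ∈ Metric.ball p r₁ := by
      rw [Metric.mem_ball, dist_eq_norm]
      exact hin.trans_le (min_le_left _ _)
    refine ⟨?_, ?_⟩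
    · rw [(hb _ hin₁).1]
      have hz0 := (hb z hzR).1.1 hz.1
      have h1 := (abs_le.1 ((hb _ hin₁).2.2 z hzR)).2
      rw [add_sub_cancel_left, inner_add_right, inner_neg_right, inner_smul_right,
        real_inner_self_eq_norm_sq] at h1
      have h2 : inner ℝ a w ≤ ‖a‖ * ‖w‖ := real_inner_le_norm _ _
      have h3 : ‖a‖ / 2 * ‖-(s • a) + w‖ ≤ ‖a‖ / 2 * (s * ‖a‖ + ‖w‖) := by gcongr
      have h4 : ‖a‖ * (3 * ‖w‖) ≤ ‖a‖ * (s * ‖a‖) := by gcongr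
      nlinarith
    · rw [Metric.mem_ball, dist_eq_norm]
      exact hin.trans_le (min_le_right _ _)
  have hseg : ∀ z ∈ Ω ∩ Metric.ball p (R' / 10),
      segment ℝ z (z + -(l • a)) ⊆ Ω ∩ Metric.ball p R := by
    rintro z hz _ ⟨α, β, hα, hβ, hαβ, rfl⟩
    have h1 := hmove z hz (β * l) 0 (by positivity) (by nlinarith) (by simp) (by simp; positivity)
    convert h1 using 1
    obtain rfl : α = 1 - β := by linarith
    module
  refine ⟨x + -(l • a), y + -(l • a), hseg x hx, ?_, ?_, ?_⟩
  · rintro _ ⟨α, β, hα, hβ, hαβ, rfl⟩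
    have hβ1 : ‖β • (y - x)‖ ≤ ‖y - x‖ := by
      rw [norm_smul, Real.norm_of_nonneg hβ]
      exact mul_le_of_le_one_left (norm_nonneg _) (by linarith)
    have h1 := hmove x hx l (β • (y - x)) hl le_rfl hβ1 (by rw [hla]; linarith)
    convert h1 using 1
    obtain rfl : α = 1 - β := by linarith
    module
  · rw [segment_symm]
    exact hseg y hy
  · have e1 : x + -(l • a) - x = -(l • a) := by abel
    have e2 : y + -(l • a) - (x + -(l • a)) = y - x := by abel
    have e3 : y - (y + -(l • a)) = l • a := by abel
    rw [e1, e2, e3, norm_neg, norm_smul, Real.norm_of_nonneg hl, hla]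
    linarith

/-- The mean value inequality on `Ω` near a boundary point. -/
theorem exists_ball_norm_sub_le (h : IsLocalDefiningFunction Ω p ρ)
    {f : EuclideanSpace ℝ (Fin n) → EuclideanSpace ℝ (Fin n)}
    {A : EuclideanSpace ℝ (Fin n) →L[ℝ] EuclideanSpace ℝ (Fin n)} {c R : ℝ} (hR : 0 < R)
    (hf : ∀ z ∈ Ω ∩ Metric.ball p R, DifferentiableAt ℝ f z)
    (hc : ∀ z ∈ Ω ∩ Metric.ball p R, ‖fderiv ℝ f z - A‖ ≤ c) :
    ∃ r > 0, ∀ x ∈ Ω ∩ Metric.ball p r, ∀ y ∈ Ω ∩ Metric.ball p r,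
      ‖f y - f x - A (y - x)‖ ≤ 7 * c * ‖y - x‖ := by
  obtain ⟨r, hr, hseg⟩ := h.exists_ball_segment_subset hR
  refine ⟨r, hr, fun x hx y hy => ?_⟩
  obtain ⟨u, v, h1, h2, h3, hlen⟩ := hseg x hx y hy
  have hc0 : 0 ≤ c := (norm_nonneg _).trans (hc x (h1 (left_mem_segment ℝ x u)))
  have hmv : ∀ {b e : EuclideanSpace ℝ (Fin n)}, segment ℝ b e ⊆ Ω ∩ Metric.ball p R →
      ‖f e - f b - A (e - b)‖ ≤ c * ‖e - b‖ := fun {b e} hbe =>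
    (convex_segment b e).norm_image_sub_le_of_norm_fderiv_le' (fun z hz => hf z (hbe hz))
      (fun z hz => hc z (hbe hz)) (left_mem_segment ℝ b e) (right_mem_segment ℝ b e)
  have e1 : f y - f x - A (y - x) = (f u - f x - A (u - x)) + (f v - f u - A (v - u)) +
      (f y - f v - A (y - v)) := by
    simp only [map_sub]; abel
  rw [e1]
  calc _ ≤ c * ‖u - x‖ + c * ‖v - u‖ + c * ‖y - v‖ :=
        norm_add₃_le.trans (add_le_add (add_le_add (hmv h1) (hmv h2)) (hmv h3))
    _ = c * (‖u - x‖ + ‖v - u‖ + ‖y - v‖) := by ring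
    _ ≤ c * (7 * ‖y - x‖) := by gcongr
    _ = 7 * c * ‖y - x‖ := by ring

end IsLocalDefiningFunction

/-- The unit outer normal does not depend on the defining function: of two different unit vectors
`a` and `b`, the difference `b - a` has negative product with `a` and positive product with `b`. -/
theorem IsUnitOuterNormal.unique {ν ν' : EuclideanSpace ℝ (Fin n)} (h : IsUnitOuterNormal Ω p ν)
    (h' : IsUnitOuterNormal Ω p ν') : ν = ν' := by
  obtain ⟨ρ, hρ, rfl⟩ := h
  obtain ⟨ρ', hρ', rfl⟩ := h'
  have hn : ∀ {a : EuclideanSpace ℝ (Fin n)}, a ≠ 0 → ‖‖a‖⁻¹ • a‖ = 1 := fun ha => by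
    rw [norm_smul, norm_inv, norm_norm, inv_mul_cancel₀ (norm_ne_zero_iff.2 ha)]
  set a := ‖gradient ρ p‖⁻¹ • gradient ρ p with ha
  set b := ‖gradient ρ' p‖⁻¹ • gradient ρ' p with hb
  have ha1 : ‖a‖ = 1 := hn hρ.gradient_ne_zero
  have hb1 : ‖b‖ = 1 := hn hρ'.gradient_ne_zero
  by_contra hne
  have hlt : inner ℝ a b < 1 := inner_lt_one_iff_real_of_norm_eq_one ha1 hb1 |>.2 hne
  -- the direction `b - a` points into `Ω` for `ρ` and out of `Ω` for `ρ'`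
  have h1 : inner ℝ (gradient ρ p) (b - a) < 0 := by
    have : gradient ρ p = ‖gradient ρ p‖ • a := by
      rw [ha, smul_inv_smul₀ (norm_ne_zero_iff.2 hρ.gradient_ne_zero)]
    rw [this, real_inner_smul_left, inner_sub_right, real_inner_self_eq_norm_sq, ha1]
    have := norm_pos_iff.2 hρ.gradient_ne_zero
    nlinarith
  have h2 : 0 < inner ℝ (gradient ρ' p) (b - a) := by
    have : gradient ρ' p = ‖gradient ρ' p‖ • b := by
      rw [hb, smul_inv_smul₀ (norm_ne_zero_iff.2 hρ'.gradient_ne_zero)]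
    rw [this, real_inner_smul_left, inner_sub_right, real_inner_self_eq_norm_sq, hb1,
      real_inner_comm]
    have := norm_pos_iff.2 hρ'.gradient_ne_zero
    nlinarith
  obtain ⟨t, ht1, ht2⟩ := ((hρ.eventually_mem h1).and (hρ'.eventually_notMem_closure h2)).exists
  exact ht2 (subset_closure ht1)

end Boundary

/-! ### The Jacobian of the boundary map and the orientation of the boundaries -/

section Orientation

variable {n d : ℕ}

open Classical in
/-- The unit outer normal of `Ω` at `p`; it is `0` if `Ω` has no unit outer normal at `p`. -/
noncomputable def outerNormal (Ω : Set (EuclideanSpace ℝ (Fin n))) (p : EuclideanSpace ℝ (Fin n)) :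
    EuclideanSpace ℝ (Fin n) :=
  if h : ∃ ν, IsUnitOuterNormal Ω p ν then h.choose else 0

theorem IsUnitOuterNormal.outerNormal_eq {Ω : Set (EuclideanSpace ℝ (Fin n))}
    {p ν : EuclideanSpace ℝ (Fin n)} (h : IsUnitOuterNormal Ω p ν) : outerNormal Ω p = ν := by
  have h' : ∃ ν, IsUnitOuterNormal Ω p ν := ⟨ν, h⟩
  rw [outerNormal, dif_pos h']
  exact h'.choose_spec.unique h

theorem IsLocalDefiningFunction.outerNormal_eq {Ω : Set (EuclideanSpace ℝ (Fin n))}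
    {p : EuclideanSpace ℝ (Fin n)} {ρ : EuclideanSpace ℝ (Fin n) → ℝ}
    (h : IsLocalDefiningFunction Ω p ρ) : outerNormal Ω p = ‖gradient ρ p‖⁻¹ • gradient ρ p :=
  h.isUnitOuterNormal.outerNormal_eq

theorem IsLocalDefiningFunction.gradient_eq {Ω : Set (EuclideanSpace ℝ (Fin n))}
    {p : EuclideanSpace ℝ (Fin n)} {ρ : EuclideanSpace ℝ (Fin n) → ℝ}
    (h : IsLocalDefiningFunction Ω p ρ) : gradient ρ p = ‖gradient ρ p‖ • outerNormal Ω p := by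
  rw [h.outerNormal_eq, smul_inv_smul₀ (norm_ne_zero_iff.2 h.gradient_ne_zero)]

theorem IsLocalDefiningFunction.norm_outerNormal {Ω : Set (EuclideanSpace ℝ (Fin n))}
    {p : EuclideanSpace ℝ (Fin n)} {ρ : EuclideanSpace ℝ (Fin n) → ℝ}
    (h : IsLocalDefiningFunction Ω p ρ) : ‖outerNormal Ω p‖ = 1 := by
  rw [h.outerNormal_eq, norm_smul, norm_inv, norm_norm,
    inv_mul_cancel₀ (norm_ne_zero_iff.2 h.gradient_ne_zero)]

theorem IsLocalDefiningFunction.inner_gradient_eq {Ω : Set (EuclideanSpace ℝ (Fin n))}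
    {p : EuclideanSpace ℝ (Fin n)} {ρ : EuclideanSpace ℝ (Fin n) → ℝ}
    (h : IsLocalDefiningFunction Ω p ρ) (v : EuclideanSpace ℝ (Fin n)) :
    inner ℝ (gradient ρ p) v = ‖gradient ρ p‖ * inner ℝ (outerNormal Ω p) v := by
  conv_lhs => rw [h.gradient_eq]
  rw [real_inner_smul_left]

theorem HasC1Boundary.continuousOn_outerNormal {Ω : Set (EuclideanSpace ℝ (Fin n))}
    (hb : HasC1Boundary Ω) (hΩ : IsOpen Ω) : ContinuousOn (outerNormal Ω) (frontier Ω) := by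
  intro p hp
  obtain ⟨ρ, h⟩ := hb p hp
  have h1 : ContinuousAt (gradient ρ) p :=
    (InnerProductSpace.toDual ℝ _).symm.continuous.continuousAt.comp
      (h.contDiffAt.continuousAt_fderiv one_ne_zero)
  have h2 : ContinuousAt (fun x => ‖gradient ρ x‖⁻¹ • gradient ρ x) p :=
    (h1.norm.inv₀ (norm_ne_zero_iff.2 h.gradient_ne_zero)).smul h1
  refine h2.continuousWithinAt.congr_of_eventuallyEq ?_ h.outerNormal_eq
  rw [Filter.EventuallyEq, eventually_nhdsWithin_iff]
  filter_upwards [h.eventually_of_mem_frontier hΩ] with x hx hxf using (hx hxf).outerNormal_eq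

theorem HasC1Boundary.uniqueDiffOn_closure {Ω : Set (EuclideanSpace ℝ (Fin n))}
    (hb : HasC1Boundary Ω) (hΩ : IsOpen Ω) : UniqueDiffOn ℝ (closure Ω) := by
  intro p hp
  by_cases hpΩ : p ∈ Ω
  · exact (hΩ.uniqueDiffWithinAt hpΩ).mono subset_closure
  · obtain ⟨ρ, h⟩ := hb p ⟨hp, fun h => hpΩ (interior_subset h)⟩
    exact h.uniqueDiffWithinAt_closure

/-- The linear map that sends `ν` to `μ` and agrees with `A` on the orthogonal complement of the
unit vector `ν`. -/
noncomputable def normalExtension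
    (A : EuclideanSpace ℝ (Fin n) →L[ℝ] EuclideanSpace ℝ (Fin n)) (ν μ : EuclideanSpace ℝ (Fin n)) :
    EuclideanSpace ℝ (Fin n) →L[ℝ] EuclideanSpace ℝ (Fin n) :=
  A + (innerSL ℝ ν).smulRight (μ - A ν)

theorem normalExtension_apply (A : EuclideanSpace ℝ (Fin n) →L[ℝ] EuclideanSpace ℝ (Fin n))
    (ν μ v : EuclideanSpace ℝ (Fin n)) :
    normalExtension A ν μ v = A v + (inner ℝ ν v : ℝ) • (μ - A ν) := rfl

theorem boundaryDet_map (L : EuclideanSpace ℝ (Fin (d + 1)) →L[ℝ] EuclideanSpace ℝ (Fin (d + 1)))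
    (ν : EuclideanSpace ℝ (Fin (d + 1))) (τ : Fin d → EuclideanSpace ℝ (Fin (d + 1))) :
    boundaryDet (L ν) (fun i => L (τ i)) = L.det * boundaryDet ν τ := by
  have h : ∀ (ν : EuclideanSpace ℝ (Fin (d + 1))) (τ : Fin d → EuclideanSpace ℝ (Fin (d + 1))),
      boundaryDet ν τ = (EuclideanSpace.basisFun (Fin (d + 1)) ℝ).toBasis.det (Fin.cons ν τ) := by
    intro ν τ
    rw [Module.Basis.det_apply]
    rfl
  rw [h, h, ContinuousLinearMap.det, ← Module.Basis.det_comp]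
  congr 1
  funext j
  refine Fin.cases ?_ (fun i => ?_) j <;> simp

/-- On tangent bases, `A` acts on the oriented volume by the determinant of its normal extension. -/
theorem boundaryDet_eq_det_normalExtension_mul
    (A : EuclideanSpace ℝ (Fin (d + 1)) →L[ℝ] EuclideanSpace ℝ (Fin (d + 1)))
    {ν : EuclideanSpace ℝ (Fin (d + 1))} (μ : EuclideanSpace ℝ (Fin (d + 1))) (hν : ‖ν‖ = 1)
    {τ : Fin d → EuclideanSpace ℝ (Fin (d + 1))} (hτ : ∀ i, inner ℝ ν (τ i) = 0) :
    boundaryDet μ (fun i => A (τ i)) = (normalExtension A ν μ).det * boundaryDet ν τ := by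
  rw [← boundaryDet_map]
  simp [normalExtension_apply, hτ, hν]

/-- An injective map between the hyperplanes orthogonal to `ν` and `μ` extends to an injective map
of the space. -/
theorem det_normalExtension_ne_zero
    {A : EuclideanSpace ℝ (Fin n) →L[ℝ] EuclideanSpace ℝ (Fin n)} {ν μ : EuclideanSpace ℝ (Fin n)}
    (hν : ‖ν‖ = 1) (hμ : ‖μ‖ = 1) (hA : ∀ τ, inner ℝ ν τ = 0 → inner ℝ μ (A τ) = 0)
    (hinj : ∀ τ, inner ℝ ν τ = 0 → A τ = 0 → τ = 0) : (normalExtension A ν μ).det ≠ 0 := by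
  intro h0
  obtain ⟨v, hv, hv0⟩ := (Submodule.ne_bot_iff _).1
    (LinearMap.bot_lt_ker_of_det_eq_zero (f := (normalExtension A ν μ :
      EuclideanSpace ℝ (Fin n) →ₗ[ℝ] EuclideanSpace ℝ (Fin n))) h0).ne'
  have hv' : normalExtension A ν μ v = 0 := hv
  set c : ℝ := inner ℝ ν v
  have hτ : inner ℝ ν (v - c • ν) = 0 := by
    rw [inner_sub_right, inner_smul_right, real_inner_self_eq_norm_sq, hν]
    simp [c]
  have h1 : c • μ + A (v - c • ν) = 0 := by
    rw [← hv', normalExtension_apply, map_sub, map_smul]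
    module
  have hc : c = 0 := by
    have := congrArg (inner ℝ μ) h1
    rw [inner_add_right, hA _ hτ, inner_smul_right, real_inner_self_eq_norm_sq, hμ] at this
    simpa using this
  rw [hc, zero_smul, zero_smul, sub_zero, zero_add] at h1
  rw [hc, zero_smul, sub_zero] at hτ
  exact hv0 (hinj v hτ h1)

/-- The dilation by `c` in the direction of the unit vector `ν` has positive determinant, being the
square of the dilation by `√c`. -/
theorem det_id_add_smulRight_pos {ν : EuclideanSpace ℝ (Fin n)} (hν : ‖ν‖ = 1) {c : ℝ}
    (hc : 0 < c) :
    0 < (ContinuousLinearMap.id ℝ (EuclideanSpace ℝ (Fin n)) +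
      (innerSL ℝ ν).smulRight ((c - 1) • ν)).det := by
  set S : ℝ → EuclideanSpace ℝ (Fin n) →L[ℝ] EuclideanSpace ℝ (Fin n) := fun c =>
    ContinuousLinearMap.id ℝ (EuclideanSpace ℝ (Fin n)) + (innerSL ℝ ν).smulRight ((c - 1) • ν)
  have hmul : ∀ a b, (S a).comp (S b) = S (a * b) := by
    intro a b
    ext1 v
    simp only [S, ContinuousLinearMap.comp_apply, add_apply,
      ContinuousLinearMap.id_apply, ContinuousLinearMap.smulRight_apply, innerSL_apply_apply,
      inner_add_right, inner_smul_right, real_inner_self_eq_norm_sq, hν]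
    module
  have hdet : ∀ a b, (S a).det * (S b).det = (S (a * b)).det := fun a b => by
    rw [← hmul]
    exact (LinearMap.det_comp _ _).symm
  have h1 : (S 1).det = 1 := by
    have : S 1 = ContinuousLinearMap.id ℝ _ := by
      ext1 v
      simp [S]
    rw [this]
    simp [ContinuousLinearMap.det]
  change 0 < (S c).det
  have hne : (S (√c)).det ≠ 0 := by
    have := hdet (√c) (√c)⁻¹
    rw [mul_inv_cancel₀ (Real.sqrt_pos.2 hc).ne', h1] at this
    exact left_ne_zero_of_mul_eq_one this
  rw [← Real.mul_self_sqrt hc.le, ← hdet]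
  exact mul_self_pos.2 hne

/-- Adding a large multiple of the rank one map `ν ↦ μ` to `A` gives a determinant of the sign of
that of the normal extension of `A`. -/
theorem exists_det_add_smulRight_mul_pos
    {A : EuclideanSpace ℝ (Fin n) →L[ℝ] EuclideanSpace ℝ (Fin n)} {ν μ : EuclideanSpace ℝ (Fin n)}
    (hν : ‖ν‖ = 1) (hM : (normalExtension A ν μ).det ≠ 0) :
    ∃ t : ℝ, 0 < t ∧
      0 < (A + (innerSL ℝ ν).smulRight (t • μ)).det * (normalExtension A ν μ).det := by
  set M := normalExtension A ν μ
  have hc : ContinuousAt (fun e : ℝ => (M + (innerSL ℝ ν).smulRight (e • A ν)).det * M.det) 0 := by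
    refine (ContinuousLinearMap.continuous_det.continuousAt.comp ?_).mul_const _
    have : (fun e : ℝ => M + (innerSL ℝ ν).smulRight (e • A ν)) =
        fun e : ℝ => M + e • (innerSL ℝ ν).smulRight (A ν) := by
      funext e
      ext1 v
      simp only [add_apply, ContinuousLinearMap.smulRight_apply,
        smul_apply]
      rw [smul_comm]
    rw [this]
    fun_prop
  have h0 : 0 < (M + (innerSL ℝ ν).smulRight ((0 : ℝ) • A ν)).det * M.det := by
    have : (innerSL ℝ ν).smulRight ((0 : ℝ) • A ν) =
        (0 : EuclideanSpace ℝ (Fin n) →L[ℝ] EuclideanSpace ℝ (Fin n)) := by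
      ext1 v; simp
    rw [this, add_zero]
    exact mul_self_pos.2 hM
  have hev := (hc.eventually_const_lt h0).filter_mono (nhdsWithin_le_nhds (s := Ioi 0))
  obtain ⟨e, he, he0⟩ := (hev.and self_mem_nhdsWithin).exists
  have he0' : 0 < e := he0
  refine ⟨e⁻¹, by positivity, ?_⟩
  -- precomposing with the dilation by `e` along `ν` rescales the large normal component to `μ`
  have hcomp : (A + (innerSL ℝ ν).smulRight (e⁻¹ • μ)).comp
      (ContinuousLinearMap.id ℝ (EuclideanSpace ℝ (Fin n)) +
      (innerSL ℝ ν).smulRight ((e - 1) • ν)) = M + (innerSL ℝ ν).smulRight (e • A ν) := by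
    ext1 v
    simp only [M, normalExtension, ContinuousLinearMap.comp_apply, add_apply,
      ContinuousLinearMap.id_apply, ContinuousLinearMap.smulRight_apply, innerSL_apply_apply,
      real_inner_self_eq_norm_sq, hν, map_add, map_smul]
    match_scalars <;> field_simp <;> ring
  have hdet : (M + (innerSL ℝ ν).smulRight (e • A ν)).det =
      (A + (innerSL ℝ ν).smulRight (e⁻¹ • μ)).det *
      (ContinuousLinearMap.id ℝ (EuclideanSpace ℝ (Fin n)) +
      (innerSL ℝ ν).smulRight ((e - 1) • ν)).det := by
    rw [← hcomp]
    exact LinearMap.det_comp _ _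
  rw [hdet, mul_right_comm] at he
  exact pos_of_mul_pos_left he (det_id_add_smulRight_pos hν he0').le

variable {Ω D : Set (EuclideanSpace ℝ (Fin n))}
  {φ : EuclideanSpace ℝ (Fin n) → EuclideanSpace ℝ (Fin n)}

/-- The Jacobian determinant of the boundary map `∂Ω → ∂D` of `φ` at `p`, with respect to the
orientations by the outer normals: the determinant of the linear map that agrees with `φ'(p)` on the
tangent space and sends outer normal to outer normal. -/
noncomputable def boundaryJacobian (Ω D : Set (EuclideanSpace ℝ (Fin n)))
    (φ : EuclideanSpace ℝ (Fin n) → EuclideanSpace ℝ (Fin n)) (p : EuclideanSpace ℝ (Fin n)) : ℝ :=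
  (normalExtension (fderivWithin ℝ φ (closure Ω) p) (outerNormal Ω p) (outerNormal D (φ p))).det

/-- The differential of `φ` maps tangent vectors to tangent vectors, and the differential of the
inverse `ψ` along `∂D` undoes it. Both maps are differentiated along the boundaries only, so the
identities hold on tangent cones. -/
theorem boundaryJacobian_ne_zero (hD : IsOpen D)
    (hΩb : HasC1Boundary Ω) (hDb : HasC1Boundary D) (hφ : ContDiffOn ℝ 1 φ (closure Ω))
    (hφb : MapsDiffeomorphically φ (frontier Ω) (frontier D))
    {p : EuclideanSpace ℝ (Fin n)} (hp : p ∈ frontier Ω) : boundaryJacobian Ω D φ p ≠ 0 := by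
  obtain ⟨hbij, -, ψ, hinv, hψ⟩ := hφb
  have hq : φ p ∈ frontier D := hbij.mapsTo hp
  obtain ⟨ρ, h⟩ := hΩb p hp
  obtain ⟨ρ', h'⟩ := hDb (φ p) hq
  set A := fderivWithin ℝ φ (closure Ω) p
  have hA : HasFDerivWithinAt φ A (frontier Ω) p :=
    ((hφ.differentiableOn one_ne_zero) p hp.1).hasFDerivWithinAt.mono frontier_subset_closure
  have htan : ∀ τ, inner ℝ (outerNormal Ω p) τ = 0 → τ ∈ tangentConeAt ℝ (frontier Ω) p := by
    intro τ hτ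
    exact h.mem_tangentConeAt_frontier (by rw [h.inner_gradient_eq, hτ, mul_zero])
  refine det_normalExtension_ne_zero h.norm_outerNormal h'.norm_outerNormal (fun τ hτ => ?_)
    fun τ hτ hAτ => ?_
  · have h1 := hA.mapsTo_tangent_cone (htan τ hτ)
    rw [hbij.image_eq] at h1
    have h2 := h'.inner_gradient_eq_zero_of_mem_tangentConeAt hD h1
    rw [h'.inner_gradient_eq] at h2
    exact (mul_eq_zero.1 h2).resolve_left (norm_ne_zero_iff.2 h'.gradient_ne_zero)
  · have hB := ((hψ.differentiableOn one_ne_zero) (φ p) hq).hasFDerivWithinAt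
    have h1 := hB.comp p hA hbij.mapsTo
    have h2 : HasFDerivWithinAt (ψ ∘ φ) (ContinuousLinearMap.id ℝ _) (frontier Ω) p :=
      (hasFDerivWithinAt_id p _).congr (fun x hx => hinv.1 hx) (hinv.1 hp)
    have h3 := h1.unique_on h2 (htan τ hτ)
    rw [ContinuousLinearMap.comp_apply, hAτ, map_zero] at h3
    exact h3.symm

theorem continuousOn_boundaryJacobian (hΩ : IsOpen Ω) (hD : IsOpen D)
    (hΩb : HasC1Boundary Ω) (hDb : HasC1Boundary D) (hφ : ContDiffOn ℝ 1 φ (closure Ω))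
    (hφb : MapsTo φ (frontier Ω) (frontier D)) :
    ContinuousOn (boundaryJacobian Ω D φ) (frontier Ω) := by
  have h1 : ContinuousOn (fderivWithin ℝ φ (closure Ω)) (frontier Ω) :=
    (hφ.continuousOn_fderivWithin (hΩb.uniqueDiffOn_closure hΩ) le_rfl).mono frontier_subset_closure
  have h2 := hΩb.continuousOn_outerNormal hΩ
  have h3 : ContinuousOn (fun p => outerNormal D (φ p)) (frontier Ω) :=
    (hDb.continuousOn_outerNormal hD).comp (hφ.continuousOn.mono frontier_subset_closure) hφb
  refine ContinuousLinearMap.continuous_det.comp_continuousOn (h1.add ?_)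
  have h4 : ContinuousOn (fun p => innerSL ℝ (outerNormal Ω p)) (frontier Ω) :=
    (innerSL ℝ).continuous.comp_continuousOn h2
  exact ((ContinuousLinearMap.smulRightL ℝ (EuclideanSpace ℝ (Fin n))
    (EuclideanSpace ℝ (Fin n))).continuous.comp_continuousOn h4).clm_apply
      (h3.sub (h1.clm_apply h2))

theorem boundaryJacobian_pos_or_neg (hΩ : IsOpen Ω) (hD : IsOpen D)
    (hΩb : HasC1Boundary Ω) (hDb : HasC1Boundary D) (hφ : ContDiffOn ℝ 1 φ (closure Ω))
    (hφb : MapsDiffeomorphically φ (frontier Ω) (frontier D))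
    (hconn : IsPreconnected (frontier Ω)) :
    (∀ p ∈ frontier Ω, 0 < boundaryJacobian Ω D φ p) ∨
      ∀ p ∈ frontier Ω, boundaryJacobian Ω D φ p < 0 := by
  have hc := continuousOn_boundaryJacobian hΩ hD hΩb hDb hφ hφb.1.mapsTo
  have hne : ∀ p ∈ frontier Ω, boundaryJacobian Ω D φ p ≠ 0 := fun p hp =>
    boundaryJacobian_ne_zero hD hΩb hDb hφ hφb hp
  by_contra! hcon
  obtain ⟨⟨p, hp, hp0⟩, q, hq, hq0⟩ := hcon
  obtain ⟨x, hx, hx0⟩ := hconn.intermediate_value hp hq hc ⟨hp0, hq0⟩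
  exact hne x hx hx0

end Orientation

section BoundaryOrientation

variable {d : ℕ} {Ω D : Set (EuclideanSpace ℝ (Fin (d + 1)))}
  {φ : EuclideanSpace ℝ (Fin (d + 1)) → EuclideanSpace ℝ (Fin (d + 1))}

theorem boundaryDet_fderivWithin_eq {p ν μ : EuclideanSpace ℝ (Fin (d + 1))}
    (hν : IsUnitOuterNormal Ω p ν) (hμ : IsUnitOuterNormal D (φ p) μ)
    {τ : Fin d → EuclideanSpace ℝ (Fin (d + 1))} (hτ : ∀ i, inner ℝ ν (τ i) = 0) :
    boundaryDet μ (fun i => fderivWithin ℝ φ (closure Ω) p (τ i)) =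
      boundaryJacobian Ω D φ p * boundaryDet ν τ := by
  have h1 : ‖ν‖ = 1 := by
    obtain ⟨ρ, hρ, -⟩ := id hν
    rw [← hν.outerNormal_eq, hρ.norm_outerNormal]
  rw [boundaryJacobian, hν.outerNormal_eq, hμ.outerNormal_eq]
  exact boundaryDet_eq_det_normalExtension_mul _ μ h1 hτ

theorem preservesBoundaryOrientation_of_pos (h : ∀ p ∈ frontier Ω, 0 < boundaryJacobian Ω D φ p) :
    PreservesBoundaryOrientation Ω D φ := fun p hp ν μ hν hμ τ hτ hpos => by
  rw [boundaryDet_fderivWithin_eq hν hμ hτ]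
  exact mul_pos (h p hp) hpos

theorem reversesBoundaryOrientation_of_neg (h : ∀ p ∈ frontier Ω, boundaryJacobian Ω D φ p < 0) :
    ReversesBoundaryOrientation Ω D φ := fun p hp ν μ hν hμ τ hτ hpos => by
  rw [boundaryDet_fderivWithin_eq hν hμ hτ]
  exact mul_neg_of_neg_of_pos (h p hp) hpos

/-- Every hyperplane has a positively oriented basis. In dimension one this fails: the empty family
need not be positive. -/
theorem exists_boundaryDet_pos (hd : d ≠ 0) {ν : EuclideanSpace ℝ (Fin (d + 1))} (hν : ‖ν‖ = 1) :
    ∃ τ : Fin d → EuclideanSpace ℝ (Fin (d + 1)), (∀ i, inner ℝ ν (τ i) = 0) ∧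
      0 < boundaryDet ν τ := by
  obtain ⟨b, hb⟩ := Orthonormal.exists_orthonormalBasis_extension_of_card_eq
    (𝕜 := ℝ) (E := EuclideanSpace ℝ (Fin (d + 1))) (ι := Fin (d + 1)) (by simp)
    (v := fun _ => ν) (s := {0}) (by
      refine ⟨fun i => by simpa using hν, fun i j hij => ?_⟩
      exact absurd (Subsingleton.elim i j) hij)
  have hb0 : b 0 = ν := hb 0 rfl
  set τ : Fin d → EuclideanSpace ℝ (Fin (d + 1)) := fun i => b i.succ
  have hcons : (Fin.cons ν τ : Fin (d + 1) → EuclideanSpace ℝ (Fin (d + 1))) = b := by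
    funext j
    refine Fin.cases (by simp [hb0]) (fun i => by simp [τ]) j
  have hort : ∀ i, inner ℝ ν (τ i) = 0 := fun i => by
    rw [← hb0]
    exact b.orthonormal.2 (Fin.succ_ne_zero i).symm
  have hdet : ∀ τ, boundaryDet ν τ =
      (EuclideanSpace.basisFun (Fin (d + 1)) ℝ).toBasis.det (Fin.cons ν τ) := by
    intro τ
    rw [Module.Basis.det_apply]
    rfl
  have hne : boundaryDet ν τ ≠ 0 := by
    rw [hdet, hcons, ← b.coe_toBasis]
    exact (Module.Basis.isUnit_det _ _).ne_zero
  rcases hne.lt_or_gt with hneg | hpos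
  · set i₀ : Fin d := ⟨0, Nat.pos_of_ne_zero hd⟩
    refine ⟨Function.update τ i₀ (-τ i₀), fun i => ?_, ?_⟩
    · by_cases hi : i = i₀
      · subst hi; simp [hort]
      · simp [hi, hort]
    · rw [hdet, Fin.cons_update, ← neg_one_smul ℝ, AlternatingMap.map_update_smul]
      have : Function.update (Fin.cons ν τ : Fin (d + 1) → EuclideanSpace ℝ (Fin (d + 1))) i₀.succ
          (τ i₀) = Fin.cons ν τ := by
        rw [← Fin.cons_update, Function.update_eq_self]
      rw [this, ← hdet, smul_eq_mul]
      linarith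
  · exact ⟨τ, hort, hpos⟩

/-- Not both orientation conditions can hold. Each is satisfied vacuously where there are no
positive bases, whence the restriction on the dimension. -/
theorem not_preserves_and_reverses (hd : d ≠ 0) (hΩb : HasC1Boundary Ω) (hDb : HasC1Boundary D)
    (hφb : MapsTo φ (frontier Ω) (frontier D)) (hne : (frontier Ω).Nonempty)
    (h1 : PreservesBoundaryOrientation Ω D φ) (h2 : ReversesBoundaryOrientation Ω D φ) : False := by
  obtain ⟨p, hp⟩ := hne
  obtain ⟨ρ, hρ⟩ := hΩb p hp
  obtain ⟨ρ', hρ'⟩ := hDb (φ p) (hφb hp)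
  have hν : ‖‖gradient ρ p‖⁻¹ • gradient ρ p‖ = 1 := by
    rw [← hρ.outerNormal_eq, hρ.norm_outerNormal]
  obtain ⟨τ, hτ, hpos⟩ := exists_boundaryDet_pos hd hν
  exact lt_asymm (h1 p hp _ _ hρ.isUnitOuterNormal hρ'.isUnitOuterNormal τ hτ hpos)
    (h2 p hp _ _ hρ.isUnitOuterNormal hρ'.isUnitOuterNormal τ hτ hpos)

end BoundaryOrientation

/-! ### The jump of the degree at a boundary point -/

section LocalDegree

variable {n : ℕ} {g : EuclideanSpace ℝ (Fin n) → EuclideanSpace ℝ (Fin n)}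
  {Ω W : Set (EuclideanSpace ℝ (Fin n))}

theorem setIntegral_comp_mul_det_fderiv {V : Set (EuclideanSpace ℝ (Fin n))} (hV : MeasurableSet V)
    (hg : ∀ x ∈ V, DifferentiableAt ℝ g x) (hinj : InjOn g V) {σ : ℝ}
    (hσ : ∀ x ∈ V, (fderiv ℝ g x).det = σ * |(fderiv ℝ g x).det|)
    (f : EuclideanSpace ℝ (Fin n) → ℝ) :
    ∫ x in V, f (g x) * (fderiv ℝ g x).det = σ * ∫ y in g '' V, f y := by
  rw [integral_image_eq_integral_abs_det_fderiv_smul volume hV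
    (fun x hx => (hg x hx).hasFDerivAt.hasFDerivWithinAt) hinj, ← integral_const_mul]
  refine setIntegral_congr_fun hV fun x hx => ?_
  simp only [smul_eq_mul]
  rw [← mul_assoc, ← hσ x hx, mul_comm]

theorem fderivWithin_closure_eq_fderiv (hΩ : IsOpen Ω) {x : EuclideanSpace ℝ (Fin n)} (hx : x ∈ Ω) :
    fderivWithin ℝ g (closure Ω) x = fderiv ℝ g x :=
  fderivWithin_of_mem_nhds (mem_of_superset (hΩ.mem_nhds hx) subset_closure)

theorem integrableOn_mul_det_fderiv (hΩ : IsOpen Ω) (hΩb : Bornology.IsBounded Ω)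
    (hu : UniqueDiffOn ℝ (closure Ω)) (hg : ContDiffOn ℝ 1 g (closure Ω))
    {u : EuclideanSpace ℝ (Fin n) → ℝ} (huc : ContinuousOn u (closure Ω)) :
    IntegrableOn (fun x => u x * (fderiv ℝ g x).det) Ω := by
  have h1 : ContinuousOn (fun x => u x * (fderivWithin ℝ g (closure Ω) x).det) (closure Ω) :=
    huc.mul (ContinuousLinearMap.continuous_det.comp_continuousOn
      (hg.continuousOn_fderivWithin hu le_rfl))
  refine ((h1.integrableOn_compact hΩb.isCompact_closure).mono_set subset_closure).congr_fun
    (fun x hx => ?_) hΩ.measurableSet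
  simp only [fderivWithin_closure_eq_fderiv hΩ hx]

theorem integrableOn_det_fderiv (hΩ : IsOpen Ω) (hΩb : Bornology.IsBounded Ω)
    (hu : UniqueDiffOn ℝ (closure Ω)) (hg : ContDiffOn ℝ 1 g (closure Ω)) :
    IntegrableOn (fun x => (fderiv ℝ g x).det) Ω := by
  simpa using integrableOn_mul_det_fderiv hΩ hΩb hu hg (u := fun _ => 1) continuousOn_const

/-- The jump of the degree at a boundary value `q = g p` is due to the part of the domain near `p`:
the part away from `p` contributes a degree that is constant near `q`. -/
theorem exists_pullbackIntegral_eq_add [NeZero n] (hW : IsOpen W) (hWb : Bornology.IsBounded W)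
    (hg : ContDiffOn ℝ 1 g W) (hgc : ContinuousOn g (closure W))
    (hJ : IntegrableOn (fun x => (fderiv ℝ g x).det) W) {p q : EuclideanSpace ℝ (Fin n)} {r σ : ℝ}
    (hinj : InjOn g (W ∩ Metric.closedBall p r))
    (hσ : ∀ x ∈ W ∩ Metric.closedBall p r, (fderiv ℝ g x).det = σ * |(fderiv ℝ g x).det|)
    (hnear : ∀ x ∈ W ∩ Metric.closedBall p r, g x ≠ q)
    (hbd : ∀ x ∈ frontier W, x ∉ Metric.ball p r → g x ≠ q) :
    ∃ r₂ > 0, ∃ k : ℝ, ∀ f : EuclideanSpace ℝ (Fin n) → ℝ, Continuous f → HasCompactSupport f →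
      tsupport f ⊆ Metric.ball q r₂ → pullbackIntegral g W f =
        k * (∫ y, f y) + σ * ∫ y in g '' (W ∩ Metric.closedBall p r), f y := by
  set W' := W \ Metric.closedBall p r
  have hW' : IsOpen W' := hW.sdiff Metric.isClosed_closedBall
  have hW'W : W' ⊆ W := sdiff_subset
  have hfr : ∀ x ∈ frontier W', g x ≠ q := by
    intro x hx
    have hxW : x ∈ closure W := closure_mono hW'W hx.1
    have hxb : x ∉ Metric.ball p r := by
      have h1 : closure W' ⊆ (Metric.ball p r)ᶜ :=
        closure_minimal (fun y hy hyb => hy.2 (Metric.ball_subset_closedBall hyb))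
          Metric.isOpen_ball.isClosed_compl
      exact h1 hx.1
    by_cases hxΩ : x ∈ W
    · refine hnear x ⟨hxΩ, by_contra fun hxc => hx.2 ?_⟩
      rw [hW'.interior_eq]
      exact ⟨hxΩ, hxc⟩
    · exact hbd x ⟨hxW, fun h => hxΩ (interior_subset h)⟩ hxb
  have hcomp : IsCompact (frontier W') :=
    (hWb.subset hW'W).isCompact_closure.of_isClosed_subset isClosed_frontier frontier_subset_closure
  have himg : IsCompact (g '' frontier W') :=
    hcomp.image_of_continuousOn
      (hgc.mono (frontier_subset_closure.trans (closure_mono hW'W)))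
  have hq : (g '' frontier W')ᶜ ∈ 𝓝 q :=
    himg.isClosed.isOpen_compl.mem_nhds (by rintro ⟨x, hx, hxq⟩; exact hfr x hx hxq)
  obtain ⟨r₂, hr₂, hball⟩ := Metric.mem_nhds_iff.1 hq
  obtain ⟨k, hk⟩ := exists_degree hW' (hWb.subset hW'W) (hg.mono hW'W)
    (hgc.mono (closure_mono hW'W)) (hJ.mono_set hW'W) (D := Metric.ball q r₂) Metric.isOpen_ball
    (Metric.isConnected_ball hr₂) (fun x hx hxb => hball hxb ⟨x, hx, rfl⟩)
  refine ⟨r₂, hr₂, k, fun f hf hfc hfs => ?_⟩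
  have hint := integrableOn_comp_mul_det hW.measurableSet (hgc.mono subset_closure) hJ hf hfc
  have h1 := integral_inter_add_sdiff (μ := volume)
    (Metric.isClosed_closedBall (x := p) (ε := r)).measurableSet hint
  rw [pullbackIntegral, ← h1, setIntegral_comp_mul_det_fderiv
    (hW.measurableSet.inter Metric.isClosed_closedBall.measurableSet)
    (fun x hx => (hg.contDiffAt (hW.mem_nhds hx.1)).differentiableAt one_ne_zero) hinj hσ, add_comm]
  congr 1
  exact hk f hf hfc hfs

theorem map_nhds_eq_of_det_fderiv_ne_zero {x : EuclideanSpace ℝ (Fin n)} (hg : ContDiffAt ℝ 1 g x)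
    (hdet : (fderiv ℝ g x).det ≠ 0) : Filter.map g (𝓝 x) = 𝓝 (g x) := by
  have h1 : HasStrictFDerivAt g
      (((fderiv ℝ g x).toContinuousLinearEquivOfDetNeZero hdet :
        EuclideanSpace ℝ (Fin n) ≃L[ℝ] EuclideanSpace ℝ (Fin n)) :
        EuclideanSpace ℝ (Fin n) →L[ℝ] EuclideanSpace ℝ (Fin n)) x := by
    rw [ContinuousLinearMap.coe_toContinuousLinearEquivOfDetNeZero]
    exact hg.hasStrictFDerivAt one_ne_zero
  exact h1.map_nhds_eq_of_equiv

/-- A local defining function can be cut off to a global `C¹` function vanishing on the boundary. -/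
theorem IsLocalDefiningFunction.exists_global {p : EuclideanSpace ℝ (Fin n)}
    {ρ : EuclideanSpace ℝ (Fin n) → ℝ} (h : IsLocalDefiningFunction Ω p ρ) (hΩ : IsOpen Ω) :
    ∃ θ : EuclideanSpace ℝ (Fin n) → ℝ, ContDiff ℝ 1 θ ∧ θ =ᶠ[𝓝 p] ρ ∧
      ∀ x ∈ frontier Ω, θ x = 0 := by
  have h1 : ∀ᶠ x in 𝓝 p, ContDiffAt ℝ 1 ρ x ∧ (x ∈ frontier Ω → ρ x = 0) :=
    (h.contDiffAt.eventually (by simp)).and (h.eventually_eq_zero_of_mem_frontier hΩ)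
  obtain ⟨r, hr, hb⟩ := Metric.eventually_nhds_iff_ball.1 h1
  obtain ⟨ζ, hζ, -, hζb, -, hζ1⟩ := exists_contDiff_cutoff (K := {p}) isCompact_singleton
    (Metric.isOpen_ball (x := p) (ε := r)) (by simpa using hr)
  refine ⟨fun x => ζ x * ρ x, ?_, ?_, fun x hx => ?_⟩
  · refine contMDiff_iff_contDiff.1 (contMDiff_of_tsupport fun x hx => ?_)
    refine contMDiffAt_iff_contDiffAt.2 (hζ.contDiffAt.mul (hb x (hζb ?_)).1)
    exact closure_mono (Function.support_mul_subset_left ζ ρ) hx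
  · filter_upwards [hζ1 p rfl] with x hx
    rw [hx, Pi.one_apply, one_mul]
  · change ζ x * ρ x = 0
    by_cases hxb : x ∈ Metric.ball p r
    · rw [(hb x hxb).2 hx, mul_zero]
    · rw [image_eq_zero_of_notMem_tsupport fun hx' => hxb (hζb hx'), zero_mul]

end LocalDegree

section Perturbation

variable {n : ℕ} {Ω D : Set (EuclideanSpace ℝ (Fin n))}
  {φ : EuclideanSpace ℝ (Fin n) → EuclideanSpace ℝ (Fin n)}

/-- Moving a point of the closure of `D` near `q ∈ ∂D` in the direction opposite to the outer normal
leads into `D`. -/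
theorem IsLocalDefiningFunction.exists_ball_add_smul_mem {q : EuclideanSpace ℝ (Fin n)}
    {ρ : EuclideanSpace ℝ (Fin n) → ℝ} (h : IsLocalDefiningFunction D q ρ) :
    ∃ r > 0, ∀ y ∈ closure D ∩ Metric.ball q r, ∀ s < (0 : ℝ),
      y + s • outerNormal D q ∈ Metric.ball q r → y + s • outerNormal D q ∈ D := by
  have ha : 0 < ‖gradient ρ q‖ := norm_pos_iff.2 h.gradient_ne_zero
  obtain ⟨r₁, hr₁, hb⟩ := h.exists_ball (δ := ‖gradient ρ q‖ / 2) (by positivity)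
  obtain ⟨r₂, hr₂, hc⟩ := Metric.eventually_nhds_iff_ball.1 h.eventually_pos_notMem_closure
  refine ⟨min r₁ r₂, lt_min hr₁ hr₂, fun y hy s hs hys => ?_⟩
  have hy1 : y ∈ Metric.ball q r₁ := Metric.ball_subset_ball (min_le_left _ _) hy.2
  have hys1 := Metric.ball_subset_ball (min_le_left r₁ r₂) hys
  have hy0 : ρ y ≤ 0 := not_lt.1 fun hpos =>
    hc y (Metric.ball_subset_ball (min_le_right _ _) hy.2) hpos hy.1
  rw [(hb _ hys1).1]
  have h1 := (abs_le.1 ((hb _ hys1).2.2 y hy1)).2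
  rw [add_sub_cancel_left, inner_smul_right, h.inner_gradient_eq, real_inner_self_eq_norm_sq,
    norm_smul, h.norm_outerNormal, Real.norm_of_nonpos hs.le] at h1
  nlinarith

/-- The map `φ` can be changed near a boundary point, keeping its boundary values, so that it
becomes a diffeomorphism of the part of `Ω` near that point into `D`, of the orientation character of
the boundary map: a large multiple of the outer normal of `D`, times a defining function of `Ω`, is
added. -/
theorem exists_perturbation (hΩ : IsOpen Ω) (hD : IsOpen D)
    (hΩb : HasC1Boundary Ω) (hDb : HasC1Boundary D) (hφ : ContDiffOn ℝ 1 φ (closure Ω))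
    (hφD : MapsTo φ (closure Ω) (closure D))
    (hφb : MapsDiffeomorphically φ (frontier Ω) (frontier D))
    {p : EuclideanSpace ℝ (Fin n)} (hp : p ∈ frontier Ω) :
    ∃ v : EuclideanSpace ℝ (Fin n) → EuclideanSpace ℝ (Fin n), ContDiff ℝ 1 v ∧
      (∀ x ∈ frontier Ω, v x = 0) ∧ ∃ r > 0,
        InjOn (fun x => φ x + v x) (Ω ∩ Metric.closedBall p r) ∧
        ∀ x ∈ Ω ∩ Metric.closedBall p r, φ x + v x ∈ D ∧
          0 < (fderiv ℝ (fun x => φ x + v x) x).det * boundaryJacobian Ω D φ p := by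
  have hu := hΩb.uniqueDiffOn_closure hΩ
  obtain ⟨ρ, h⟩ := hΩb p hp
  obtain ⟨ρ', h'⟩ := hDb (φ p) (hφb.1.mapsTo hp)
  have ha : 0 < ‖gradient ρ p‖ := norm_pos_iff.2 h.gradient_ne_zero
  set A := fderivWithin ℝ φ (closure Ω) p
  set μ := outerNormal D (φ p)
  set ν := outerNormal Ω p
  obtain ⟨t, ht, htdet⟩ := exists_det_add_smulRight_mul_pos (A := A) (μ := μ) h.norm_outerNormal
    (boundaryJacobian_ne_zero hD hΩb hDb hφ hφb hp)
  obtain ⟨θ, hθ, hθρ, hθ0⟩ := h.exists_global hΩ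
  -- with this factor the derivative of `v` at `p` is the rank one map `ν ↦ t μ`
  set c : ℝ := t / ‖gradient ρ p‖
  have hc : 0 < c := by positivity
  set v : EuclideanSpace ℝ (Fin n) → EuclideanSpace ℝ (Fin n) := fun x => θ x • (c • μ)
  have hv : ContDiff ℝ 1 v := hθ.smul contDiff_const
  have hv0 : ∀ x ∈ frontier Ω, v x = 0 := fun x hx => by simp only [v, hθ0 x hx, zero_smul]
  set g : EuclideanSpace ℝ (Fin n) → EuclideanSpace ℝ (Fin n) := fun x => φ x + v x
  have hg : ContDiffOn ℝ 1 g (closure Ω) := hφ.add hv.contDiffOn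
  set H := A + (innerSL ℝ ν).smulRight (t • μ)
  have hH : fderivWithin ℝ g (closure Ω) p = H := by
    have h1 : HasFDerivAt v ((fderiv ℝ θ p).smulRight (c • μ)) p :=
      ((hθ.differentiable one_ne_zero p).hasFDerivAt).smul_const (c • μ)
    have h2 := ((hφ.differentiableOn one_ne_zero) p hp.1).hasFDerivWithinAt.add
      h1.hasFDerivWithinAt
    refine (h2.fderivWithin (hu p hp.1)).trans ?_
    congr 1
    ext1 w
    rw [ContinuousLinearMap.smulRight_apply, ContinuousLinearMap.smulRight_apply,
      hθρ.fderiv_eq, ← inner_gradient_eq_fderiv, h.inner_gradient_eq, innerSL_apply_apply]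
    simp only [c, smul_smul]
    congr 1
    field_simp
    rfl
  have hHdet : H.det ≠ 0 := left_ne_zero_of_mul htdet.ne'
  -- the derivative stays so close to `H` that the mean value inequality, with its factor `7`, loses
  -- at most half of the lower bound for `H`
  obtain ⟨K, hK, hanti⟩ :=
    (H : EuclideanSpace ℝ (Fin n) →ₗ[ℝ] EuclideanSpace ℝ (Fin n)).exists_antilipschitzWith (by
      by_contra hne
      exact hHdet (by
        by_contra hdet
        exact hne (LinearMap.ker_eq_bot.2
          ((H.toContinuousLinearEquivOfDetNeZero hdet).injective))))
  have hcont : ContinuousWithinAt (fderivWithin ℝ g (closure Ω)) (closure Ω) p :=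
    hg.continuousOn_fderivWithin hu le_rfl p hp.1
  have hev1 : ∀ᶠ z in 𝓝[closure Ω] p, ‖fderivWithin ℝ g (closure Ω) z - H‖ < 1 / (14 * K) := by
    have h1 := (hcont.sub (continuousWithinAt_const (b := H))).norm
    refine h1.eventually_lt_const ?_
    change ‖fderivWithin ℝ g (closure Ω) p - H‖ < _
    rw [hH, sub_self, norm_zero]
    positivity
  have hev2 : ∀ᶠ z in 𝓝[closure Ω] p,
      0 < (fderivWithin ℝ g (closure Ω) z).det * boundaryJacobian Ω D φ p := by
    have h1 : ContinuousWithinAt (fun z => (fderivWithin ℝ g (closure Ω) z).det *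
        boundaryJacobian Ω D φ p) (closure Ω) p :=
      (ContinuousLinearMap.continuous_det.continuousAt.comp_continuousWithinAt hcont).mul_const _
    refine h1.eventually_const_lt ?_
    change 0 < (fderivWithin ℝ g (closure Ω) p).det * _
    rw [hH]
    exact htdet
  obtain ⟨s, hs, hsD⟩ := h'.exists_ball_add_smul_mem
  have hgp : g p = φ p := by simp only [g, hv0 p hp, add_zero]
  have hev3 : ∀ᶠ z in 𝓝[closure Ω] p, z ∈ Ω → g z ∈ D := by
    have h1 : ∀ᶠ z in 𝓝[closure Ω] p, φ z ∈ Metric.ball (φ p) s :=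
      (hφ.continuousOn p hp.1) (Metric.ball_mem_nhds _ hs)
    have h2 : ∀ᶠ z in 𝓝[closure Ω] p, g z ∈ Metric.ball (φ p) s := by
      have := hg.continuousOn p hp.1
      rw [ContinuousWithinAt, hgp] at this
      exact this (Metric.ball_mem_nhds _ hs)
    filter_upwards [h1, h2, mem_nhdsWithin_of_mem_nhds hθρ, mem_nhdsWithin_of_mem_nhds h.mem_iff,
      self_mem_nhdsWithin] with z hz1 hz2 hz3 hz4 hz5 hzΩ
    have hz3' : θ z = ρ z := hz3
    have hz4' : z ∈ Ω ↔ ρ z < 0 := hz4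
    have hneg : θ z * c < 0 := mul_neg_of_neg_of_pos (by rw [hz3']; exact hz4'.1 hzΩ) hc
    have e : g z = φ z + (θ z * c) • μ := by simp only [g, v, smul_smul]
    rw [e] at hz2 ⊢
    exact hsD _ ⟨hφD hz5, hz1⟩ _ hneg hz2
  obtain ⟨R, hR, hball⟩ := Metric.mem_nhdsWithin_iff.1 (inter_mem hev1 (inter_mem hev2 hev3))
  have hin : ∀ z ∈ Ω ∩ Metric.ball p R, z ∈ Metric.ball p R ∩ closure Ω := fun z hz =>
    ⟨hz.2, subset_closure hz.1⟩
  have hdiff : ∀ z ∈ Ω, DifferentiableAt ℝ g z := fun z hz =>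
    ((hg.mono subset_closure).contDiffAt (hΩ.mem_nhds hz)).differentiableAt one_ne_zero
  obtain ⟨r₀, hr₀, hmv⟩ := h.exists_ball_norm_sub_le (f := g) (A := H) (c := 1 / (14 * K)) hR
    (fun z hz => hdiff z hz.1) (fun z hz => by
      rw [← fderivWithin_closure_eq_fderiv hΩ hz.1]
      exact le_of_lt (hball (hin z hz)).1)
  have hr : 0 < min r₀ R / 2 := half_pos (lt_min hr₀ hR)
  have hsub : ∀ x ∈ Ω ∩ Metric.closedBall p (min r₀ R / 2),
      x ∈ Ω ∩ Metric.ball p r₀ ∧ x ∈ Ω ∩ Metric.ball p R := by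
    rintro x ⟨hx, hxb⟩
    rw [Metric.mem_closedBall] at hxb
    have h1 := min_le_left r₀ R
    have h2 := min_le_right r₀ R
    exact ⟨⟨hx, by rw [Metric.mem_ball]; linarith⟩, hx, by rw [Metric.mem_ball]; linarith⟩
  refine ⟨v, hv, hv0, min r₀ R / 2, hr, fun x hx y hy hxy => ?_, fun x hx => ?_⟩
  · have h1 := hmv x (hsub x hx).1 y (hsub y hy).1
    have hxy' : g x = g y := hxy
    rw [hxy', sub_self, zero_sub, norm_neg] at h1
    have h2 := hanti.le_mul_dist y x
    have h3 : dist ((H : EuclideanSpace ℝ (Fin n) →ₗ[ℝ] EuclideanSpace ℝ (Fin n)) y)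
        ((H : EuclideanSpace ℝ (Fin n) →ₗ[ℝ] EuclideanSpace ℝ (Fin n)) x) = ‖H (y - x)‖ := by
      rw [dist_eq_norm, map_sub]; rfl
    rw [h3, dist_eq_norm] at h2
    have hK' : (0 : ℝ) < K := hK
    have h4 : ‖y - x‖ ≤ 1 / 2 * ‖y - x‖ := by
      calc ‖y - x‖ ≤ K * ‖H (y - x)‖ := h2
        _ ≤ K * (7 * (1 / (14 * K)) * ‖y - x‖) := by gcongr
        _ = 1 / 2 * ‖y - x‖ := by field_simp; ring
    have h5 : ‖y - x‖ = 0 := le_antisymm (by linarith) (norm_nonneg _)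
    exact (sub_eq_zero.1 (norm_eq_zero.1 h5)).symm
  · have h1 := (hball (hin x (hsub x hx).2)).2
    refine ⟨h1.2 hx.1, ?_⟩
    rw [← fderivWithin_closure_eq_fderiv hΩ hx.1]
    exact h1.1

end Perturbation

/-! ### The change of variables formula -/

section Final

variable {n : ℕ} {Ω D : Set (EuclideanSpace ℝ (Fin n))}
  {φ : EuclideanSpace ℝ (Fin n) → EuclideanSpace ℝ (Fin n)}

theorem det_fderiv_eq_zero_of_mem_frontier (hΩ : IsOpen Ω) (hDb : HasC1Boundary D)
    (hφ : ContDiffOn ℝ 1 φ (closure Ω)) (hφD : MapsTo φ (closure Ω) (closure D))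
    {x : EuclideanSpace ℝ (Fin n)} (hx : x ∈ Ω) (hxD : φ x ∈ frontier D) :
    (fderiv ℝ φ x).det = 0 := by
  by_contra hdet
  obtain ⟨ρ, h⟩ := hDb _ hxD
  have h1 := map_nhds_eq_of_det_fderiv_ne_zero
    ((hφ.mono subset_closure).contDiffAt (hΩ.mem_nhds hx)) hdet
  refine h.frequently_notMem_closure ?_
  rw [← h1, eventually_map]
  filter_upwards [hΩ.mem_nhds hx] with y hy
  exact not_not.2 (hφD (subset_closure hy))

/-- A change of the map that keeps its boundary values does not change the integral against a kernel
supported away from these values. -/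
theorem pullbackIntegral_add_eq (hn : n ≠ 0) (hΩ : IsOpen Ω) (hΩbd : Bornology.IsBounded Ω)
    (hu : UniqueDiffOn ℝ (closure Ω)) (hφ : ContDiffOn ℝ 1 φ (closure Ω))
    {v : EuclideanSpace ℝ (Fin n) → EuclideanSpace ℝ (Fin n)} (hv : ContDiff ℝ 1 v)
    (hv0 : ∀ x ∈ frontier Ω, v x = 0) {η : EuclideanSpace ℝ (Fin n) → ℝ} {ε : ℝ}
    (hη : IsJacobianBump η ε) {y : EuclideanSpace ℝ (Fin n)}
    (hy : ∀ x ∈ frontier Ω, φ x ∉ Metric.closedBall y ε) :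
    pullbackIntegral (fun x => φ x + v x) Ω (fun z => η (z - y)) =
      pullbackIntegral φ Ω (fun z => η (z - y)) := by
  have : NeZero n := ⟨hn⟩
  obtain ⟨Φ, hΦ, hd⟩ := hη.exists_primitive_translate y
  have h := setIntegral_homotopy_eq_zero volume hΩ hΩbd (hφ.mono subset_closure) hφ.continuousOn
    hv.contDiffOn hv.continuous.continuousOn hΦ (fun x hx t _ hmem => by
      simp only [hd, hv0 x hx, smul_zero, add_zero] at hmem
      exact hy x hx (hη.tsupport_translate_subset y hmem))
  simp only [hd] at h
  have hi : ∀ {g : EuclideanSpace ℝ (Fin n) → EuclideanSpace ℝ (Fin n)},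
      ContDiffOn ℝ 1 g (closure Ω) →
      IntegrableOn (fun x => η (g x - y) * (fderiv ℝ g x).det) Ω := fun {g} hg =>
    integrableOn_mul_det_fderiv hΩ hΩbd hu hg
      (hη.continuous.comp_continuousOn (hg.continuousOn.sub continuousOn_const))
  rw [integral_sub (hi (hφ.add hv.contDiffOn)) (hi hφ)] at h
  exact sub_eq_zero.1 h

/-- The degree of `φ` over `D` is the sign of its boundary Jacobian at any boundary point `p`: the
degree of a perturbed map with the same boundary values jumps by that sign across `∂D` at `φ p`, and
it is `0` outside of `D`. -/
theorem pullbackIntegral_eq_sign_mul_integral (hn : n ≠ 0) (hΩ : IsOpen Ω)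
    (hΩbd : Bornology.IsBounded Ω) (hD : IsOpen D) (hDc : IsConnected D)
    (hΩb : HasC1Boundary Ω) (hDb : HasC1Boundary D) (hφ : ContDiffOn ℝ 1 φ (closure Ω))
    (hφD : MapsTo φ (closure Ω) (closure D))
    (hφb : MapsDiffeomorphically φ (frontier Ω) (frontier D))
    {p : EuclideanSpace ℝ (Fin n)} (hp : p ∈ frontier Ω) {f : EuclideanSpace ℝ (Fin n) → ℝ}
    (hf : Continuous f) (hfc : HasCompactSupport f) (hfD : tsupport f ⊆ D) :
    pullbackIntegral φ Ω f = Real.sign (boundaryJacobian Ω D φ p) * ∫ y, f y := by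
  have : NeZero n := ⟨hn⟩
  have hu := hΩb.uniqueDiffOn_closure hΩ
  have hfrD : ∀ x ∈ frontier Ω, φ x ∉ D := fun x hx hxD =>
    (hφb.1.mapsTo hx).2 (by rwa [hD.interior_eq])
  obtain ⟨k, hk⟩ := exists_degree hΩ hΩbd (hφ.mono subset_closure) hφ.continuousOn
    (integrableOn_det_fderiv hΩ hΩbd hu hφ) hD hDc hfrD
  suffices hkσ : k = Real.sign (boundaryJacobian Ω D φ p) by
    rw [← hkσ]
    exact hk f hf hfc hfD
  obtain ⟨v, hv, hv0, r, hr, hinj, hnear⟩ := exists_perturbation hΩ hD hΩb hDb hφ hφD hφb hp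
  set g : EuclideanSpace ℝ (Fin n) → EuclideanSpace ℝ (Fin n) := fun x => φ x + v x
  set σ := Real.sign (boundaryJacobian Ω D φ p)
  have hg : ContDiffOn ℝ 1 g (closure Ω) := hφ.add hv.contDiffOn
  have hgfr : ∀ x ∈ frontier Ω, g x = φ x := fun x hx => by simp only [g, hv0 x hx, add_zero]
  have hσ : ∀ x ∈ Ω ∩ Metric.closedBall p r, (fderiv ℝ g x).det = σ * |(fderiv ℝ g x).det| := by
    intro x hx
    rcases pos_and_pos_or_neg_and_neg_of_mul_pos (hnear x hx).2 with ⟨h1, h2⟩ | ⟨h1, h2⟩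
    · simp only [σ, Real.sign_of_pos h2, abs_of_pos h1, one_mul]
    · simp only [σ, Real.sign_of_neg h2, abs_of_neg h1, neg_mul_neg, one_mul]
  obtain ⟨r₂, hr₂, k', hk'⟩ := exists_pullbackIntegral_eq_add (q := φ p) hΩ hΩbd
    (hg.mono subset_closure) hg.continuousOn (integrableOn_det_fderiv hΩ hΩbd hu hg) hinj hσ
    (fun x hx hxp => hfrD p hp (hxp ▸ (hnear x hx).1))
    (fun x hx hxb hxp => by
      rw [hgfr x hx] at hxp
      rw [hφb.1.injOn hx hp hxp] at hxb
      exact hxb (Metric.mem_ball_self hr))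
  have hgp : g p = φ p := hgfr p hp
  set I := g '' (Ω ∩ Metric.closedBall p r)
  have hID : I ⊆ D := by
    rintro _ ⟨x, hx, rfl⟩
    exact (hnear x hx).1
  -- the degree of `g` near `φ p` is read off from two kernels, on either side of `∂D`; first,
  -- a kernel supported in the image of the part of `Ω` near `p`
  have h0 : k = k' + σ := by
    have hev : ∀ᶠ x in 𝓝[closure Ω] p, g x ∈ Metric.ball (φ p) r₂ ∧ x ∈ Metric.ball p r := by
      refine Filter.Eventually.and ?_ (mem_nhdsWithin_of_mem_nhds (Metric.ball_mem_nhds p hr))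
      have := hg.continuousOn p hp.1
      rw [ContinuousWithinAt, hgp] at this
      exact this (Metric.ball_mem_nhds _ hr₂)
    obtain ⟨x, hx, hx'⟩ := ((mem_closure_iff_frequently.1 hp.1).and_eventually
      (eventually_nhdsWithin_iff.1 hev)).exists
    obtain ⟨hxr₂, hxr⟩ := hx' (subset_closure hx)
    have hxV : x ∈ Ω ∩ Metric.closedBall p r := ⟨hx, Metric.ball_subset_closedBall hxr⟩
    have hImem : I ∈ 𝓝 (g x) := by
      rw [← map_nhds_eq_of_det_fderiv_ne_zero ((hg.mono subset_closure).contDiffAt (hΩ.mem_nhds hx))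
        (left_ne_zero_of_mul (hnear x hxV).2.ne')]
      exact image_mem_map (mem_of_superset (inter_mem (hΩ.mem_nhds hx)
        (Metric.isOpen_ball.mem_nhds hxr))
        (inter_subset_inter_right Ω Metric.ball_subset_closedBall))
    obtain ⟨e, he, hball⟩ := Metric.nhds_basis_closedBall.mem_iff.1
      (inter_mem hImem (Metric.isOpen_ball.mem_nhds hxr₂))
    obtain ⟨η, hη⟩ := exists_isJacobianBump (n := n) he
    have hsupp := hη.tsupport_translate_subset (g x)
    have hc : Continuous fun z => η (z - g x) := hη.continuous.comp (by fun_prop)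
    have hcs := hη.hasCompactSupport_translate (g x)
    have h2 := hk' _ hc hcs (hsupp.trans fun z hz => (hball hz).2)
    rw [pullbackIntegral_add_eq hn hΩ hΩbd hu hφ hv hv0 hη
      (fun x hx hxb => hfrD x hx (hID (hball hxb).1)),
      hk _ hc hcs (hsupp.trans fun z hz => hID (hball hz).1),
      setIntegral_eq_integral_of_forall_compl_eq_zero (fun z hz =>
        image_eq_zero_of_notMem_tsupport (f := fun z => η (z - g x))
          fun hz' => hz (hball (hsupp hz')).1),
      integral_sub_right_eq_self η (g x), hη.integral_eq_one] at h2
    linarith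
  -- a kernel supported outside of the closure of `D`
  have h1 : k' = 0 := by
    obtain ⟨ρ, hρ⟩ := hDb _ (hφb.1.mapsTo hp)
    obtain ⟨y, hy, hyr⟩ := (hρ.frequently_notMem_closure.and_eventually
      (Metric.ball_mem_nhds (φ p) hr₂)).exists
    obtain ⟨e, he, hball⟩ := Metric.nhds_basis_closedBall.mem_iff.1
      (inter_mem (isClosed_closure.isOpen_compl.mem_nhds hy) (Metric.isOpen_ball.mem_nhds hyr))
    obtain ⟨η, hη⟩ := exists_isJacobianBump (n := n) he
    have h2 := hk' (fun z => η (z - y)) (hη.continuous.comp (by fun_prop))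
      (hη.hasCompactSupport_translate y)
      ((hη.tsupport_translate_subset y).trans fun z hz => (hball hz).2)
    have hout : ∀ z ∈ closure D, η (z - y) = 0 := fun z hz =>
      image_eq_zero_of_notMem_tsupport (f := fun z => η (z - y))
        fun hz' => (hball (hη.tsupport_translate_subset y hz')).1 hz
    rw [pullbackIntegral_add_eq hn hΩ hΩbd hu hφ hv hv0 hη
      (fun x hx hxb => (hball hxb).1 (hφD hx.1)), integral_sub_right_eq_self η y,
      hη.integral_eq_one, pullbackIntegral,
      setIntegral_eq_zero_of_forall_eq_zero (fun x hx => by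
        rw [hout _ (hφD (subset_closure hx)), zero_mul]),
      setIntegral_eq_zero_of_forall_eq_zero (t := I)
        (fun z hz => hout z (subset_closure (hID hz)))] at h2
    linarith
  rw [h0, h1, zero_add]

/-- Continuous functions with compact support in a bounded open set that converge to its indicator
function. -/
theorem exists_seq_tendsto_indicator (hD : IsOpen D) (hDb : Bornology.IsBounded D)
    (hDne : Dᶜ.Nonempty) :
    ∃ χ : ℕ → EuclideanSpace ℝ (Fin n) → ℝ, (∀ j, Continuous (χ j)) ∧
      (∀ j, ∃ K ⊆ D, IsCompact K ∧ ∀ y ∉ K, χ j y = 0) ∧ (∀ j y, |χ j y| ≤ 1) ∧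
      ∀ y ∈ D, Tendsto (fun j => χ j y) atTop (𝓝 1) := by
  set δ : EuclideanSpace ℝ (Fin n) → ℝ := fun y => Metric.infDist y Dᶜ
  have hδ : Continuous δ := Metric.continuous_infDist_pt _
  have hδ0 : ∀ y, 0 < δ y ↔ y ∈ D := fun y => by
    rw [← hD.isClosed_compl.notMem_iff_infDist_pos hDne, mem_compl_iff, not_not]
  refine ⟨fun j y => min 1 (max 0 ((j : ℝ) * δ y - 1)), fun j => by fun_prop, fun j => ?_,
    fun j y => ?_, fun y hy => ?_⟩
  · have hsub : {y | 1 ≤ (j : ℝ) * δ y} ⊆ D := by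
      intro y hy
      rw [← hδ0]
      by_contra hneg
      have h1 : (1 : ℝ) ≤ j * δ y := hy
      have : (j : ℝ) * δ y ≤ 0 := mul_nonpos_of_nonneg_of_nonpos j.cast_nonneg (not_lt.1 hneg)
      linarith
    refine ⟨{y | 1 ≤ (j : ℝ) * δ y}, hsub, ?_, fun y hy => ?_⟩
    · exact Metric.isCompact_of_isClosed_isBounded
        (isClosed_le continuous_const (continuous_const.mul hδ)) (hDb.subset hsub)
    · have h1 : (j : ℝ) * δ y < 1 := not_le.1 hy
      simp only
      rw [max_eq_left (by linarith), min_eq_right zero_le_one]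
  · rw [abs_of_nonneg (le_min zero_le_one (le_max_left _ _))]
    exact min_le_left _ _
  · refine tendsto_const_nhds.congr' ?_
    filter_upwards [(tendsto_natCast_atTop_atTop (R := ℝ)).eventually_ge_atTop (2 / δ y)] with j hj
    have h1 : 2 ≤ (j : ℝ) * δ y := (div_le_iff₀ ((hδ0 y).2 hy)).1 hj
    rw [max_eq_right (by linarith), min_eq_left (by linarith)]

theorem setIntegral_comp_mul_det_eq (hn : n ≠ 0) (hΩ : IsOpen Ω)
    (hΩbd : Bornology.IsBounded Ω) (hD : IsOpen D) (hDc : IsConnected D)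
    (hDbd : Bornology.IsBounded D)
    (hΩb : HasC1Boundary Ω) (hDb : HasC1Boundary D) (hφ : ContDiffOn ℝ 1 φ (closure Ω))
    (hφD : MapsTo φ (closure Ω) (closure D))
    (hφb : MapsDiffeomorphically φ (frontier Ω) (frontier D))
    {p : EuclideanSpace ℝ (Fin n)} (hp : p ∈ frontier Ω) {f : EuclideanSpace ℝ (Fin n) → ℝ}
    (hf : ContinuousOn f (closure D)) :
    ∫ x in Ω, f (φ x) * (fderiv ℝ φ x).det =
      Real.sign (boundaryJacobian Ω D φ p) * ∫ y in D, f y := by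
  have hu := hΩb.uniqueDiffOn_closure hΩ
  have hDne : Dᶜ.Nonempty := ⟨φ p, fun h => (hφb.1.mapsTo hp).2 (by rwa [hD.interior_eq])⟩
  obtain ⟨χ, hχ, hχK, hχ1, hχlim⟩ := exists_seq_tendsto_indicator hD hDbd hDne
  obtain ⟨F, hF⟩ := ContinuousMap.exists_restrict_eq isClosed_closure
    ⟨(closure D).domRestrict f, hf.domRestrict⟩
  have hFf : ∀ y ∈ closure D, F y = f y := fun y hy => DFunLike.congr_fun hF ⟨y, hy⟩
  have hzero : ∀ j, ∀ y ∉ D, χ j y = 0 := fun j y hy => by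
    obtain ⟨K, hKD, -, hK⟩ := hχK j
    exact hK y fun h => hy (hKD h)
  have heq : ∀ j, ∫ x in Ω, (χ j (φ x) * F (φ x)) * (fderiv ℝ φ x).det =
      Real.sign (boundaryJacobian Ω D φ p) * ∫ y in D, χ j y * f y := by
    intro j
    obtain ⟨K, hKD, hK, hK0⟩ := hχK j
    have hsupp : tsupport (fun y => χ j y * F y) ⊆ K := by
      refine closure_minimal (fun y hy => by_contra fun h => hy ?_) hK.isClosed
      simp only [hK0 y h, zero_mul]
    have h1 := pullbackIntegral_eq_sign_mul_integral hn hΩ hΩbd hD hDc hΩb hDb hφ hφD hφb hp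
      ((hχ j).mul F.continuous) (hK.of_isClosed_subset (isClosed_tsupport _) hsupp)
      (hsupp.trans hKD)
    refine h1.trans ?_
    rw [← setIntegral_eq_integral_of_forall_compl_eq_zero (s := D)
      fun y hy => by simp only [Pi.mul_apply, hzero j y hy, zero_mul]]
    congr 1
    refine setIntegral_congr_fun hD.measurableSet fun y hy => ?_
    simp only [Pi.mul_apply, hFf y (subset_closure hy)]
  have hint : IntegrableOn (fun x => F (φ x) * (fderiv ℝ φ x).det) Ω :=
    integrableOn_mul_det_fderiv hΩ hΩbd hu hφ (F.continuous.comp_continuousOn hφ.continuousOn)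
  have hintD : IntegrableOn f D :=
    (hf.integrableOn_compact hDbd.isCompact_closure).mono_set subset_closure
  have hlimΩ : Tendsto (fun j => ∫ x in Ω, (χ j (φ x) * F (φ x)) * (fderiv ℝ φ x).det) atTop
      (𝓝 (∫ x in Ω, f (φ x) * (fderiv ℝ φ x).det)) := by
    refine tendsto_integral_of_dominated_convergence
      (fun x => ‖F (φ x) * (fderiv ℝ φ x).det‖) (fun j => ?_) hint.norm (fun j => ?_) ?_
    · exact (integrableOn_mul_det_fderiv hΩ hΩbd hu hφ (((hχ j).mul F.continuous).comp_continuousOn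
        hφ.continuousOn)).aestronglyMeasurable
    · refine Eventually.of_forall fun x => ?_
      rw [mul_assoc, norm_mul]
      exact mul_le_of_le_one_left (norm_nonneg _) (hχ1 j _)
    · refine (ae_restrict_iff' hΩ.measurableSet).2 (Eventually.of_forall fun x hx => ?_)
      have hxD : φ x ∈ closure D := hφD (subset_closure hx)
      rw [← hFf _ hxD]
      by_cases h : φ x ∈ D
      · simpa using ((hχlim _ h).mul_const (F (φ x))).mul_const ((fderiv ℝ φ x).det)
      · have h0 := det_fderiv_eq_zero_of_mem_frontier hΩ hDb hφ hφD hx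
          ⟨hxD, by rwa [hD.interior_eq]⟩
        simp [h0]
  have hlimD : Tendsto (fun j => ∫ y in D, χ j y * f y) atTop (𝓝 (∫ y in D, f y)) := by
    refine tendsto_integral_of_dominated_convergence (fun y => ‖f y‖) (fun j => ?_) hintD.norm
      (fun j => ?_) ?_
    · exact (hχ j).aestronglyMeasurable.mul hintD.aestronglyMeasurable
    · refine Eventually.of_forall fun y => ?_
      rw [norm_mul]
      exact mul_le_of_le_one_left (norm_nonneg _) (hχ1 j _)
    · refine (ae_restrict_iff' hD.measurableSet).2 (Eventually.of_forall fun y hy => ?_)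
      simpa using (hχlim _ hy).mul_const (f y)
  refine tendsto_nhds_unique hlimΩ ?_
  simp only [heq]
  exact hlimD.const_mul _

theorem IsSinglyParametrized.isPreconnected {d : ℕ} {S : Set (EuclideanSpace ℝ (Fin (d + 1)))}
    (h : IsSinglyParametrized S) : IsPreconnected S := by
  obtain ⟨U, x, hU, rfl⟩ := h
  refine IsPreconnected.image ?_ x hU.contDiffOn.continuousOn
  rw [hU.eq_closure]
  exact hU.isConnected.isPreconnected.closure

/-- The boundary of a nonempty bounded open set has more than one point: every line through a point
of the set meets the boundary on both sides. -/
theorem frontier_nontrivial {d : ℕ} {Ω : Set (EuclideanSpace ℝ (Fin (d + 1)))} (hΩ : IsOpen Ω)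
    (hne : Ω.Nonempty) (hΩbd : Bornology.IsBounded Ω) : (frontier Ω).Nontrivial := by
  obtain ⟨x, hx⟩ := hne
  obtain ⟨e, he⟩ := exists_ne (0 : EuclideanSpace ℝ (Fin (d + 1)))
  obtain ⟨R, hR⟩ := hΩbd.subset_closedBall x
  have hray : ∀ u : EuclideanSpace ℝ (Fin (d + 1)), u ≠ 0 →
      ∃ t : ℝ, 0 < t ∧ x + t • u ∈ frontier Ω := by
    intro u hu
    have hu' : 0 < ‖u‖ := norm_pos_iff.2 hu
    have hcon : IsPreconnected ((fun t : ℝ => x + t • u) '' Ici 0) :=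
      isPreconnected_Ici.image _ (by fun_prop)
    have hout : x + ((|R| + 1) / ‖u‖) • u ∉ Ω := fun hmem => by
      have h1 := hR hmem
      rw [Metric.mem_closedBall, dist_eq_norm, add_sub_cancel_left, norm_smul,
        Real.norm_of_nonneg (by positivity), div_mul_cancel₀ _ hu'.ne'] at h1
      linarith [le_abs_self R]
    obtain ⟨t, ht, hf⟩ : ∃ t ∈ Ici (0 : ℝ), x + t • u ∈ frontier Ω := by
      by_contra! hno
      refine hout (hcon.subset_of_closure_inter_subset hΩ ⟨x, ⟨0, by simp⟩, hx⟩ ?_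
        ⟨_, mem_Ici.2 (by positivity), rfl⟩)
      rintro _ ⟨hcl, t, ht, rfl⟩
      by_contra hmem
      exact hno t ht ⟨hcl, by rwa [hΩ.interior_eq]⟩
    have ht' : (0 : ℝ) ≤ t := ht
    refine ⟨t, lt_of_le_of_ne ht' ?_, hf⟩
    rintro rfl
    simp only [zero_smul, add_zero] at hf
    exact hf.2 (by rwa [hΩ.interior_eq])
  obtain ⟨s, hs, hsf⟩ := hray e he
  obtain ⟨t, ht, htf⟩ := hray (-e) (neg_ne_zero.2 he)
  refine ⟨_, hsf, _, htf, fun heq => ?_⟩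
  have h1 : (s + t) • e = 0 := by
    have := add_left_cancel heq
    rw [add_smul, this]
    module
  rcases smul_eq_zero.1 h1 with h2 | h2
  · linarith
  · exact he h2

theorem IsSinglyParametrized.ne_zero_of_nontrivial {d : ℕ}
    {S : Set (EuclideanSpace ℝ (Fin (d + 1)))} (h : IsSinglyParametrized S) (hS : S.Nontrivial) :
    d ≠ 0 := by
  rintro rfl
  obtain ⟨U, x, -, rfl⟩ := h
  have : U.Subsingleton := subsingleton_of_subsingleton
  exact hS.not_subsingleton (this.image x)

end Final

/-- For `d = 0` a singly parametrized boundary would be a single point, which is excluded by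
`frontier_nontrivial`. -/
theorem theorem3 {d : ℕ} (Ω D : Set (EuclideanSpace ℝ (Fin (d + 1))))
    (hΩ : IsBoundedDomain Ω) (hD : IsBoundedDomain D)
    (hΩb : HasC1Boundary Ω) (hDb : HasC1Boundary D)
    (hpar : IsSinglyParametrized (frontier Ω))
    (φ : EuclideanSpace ℝ (Fin (d + 1)) → EuclideanSpace ℝ (Fin (d + 1)))
    (hφ : ContDiffOn ℝ 1 φ (closure Ω)) (hφD : MapsTo φ (closure Ω) (closure D))
    (hφb : MapsDiffeomorphically φ (frontier Ω) (frontier D)) :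
    (PreservesBoundaryOrientation Ω D φ ∨ ReversesBoundaryOrientation Ω D φ) ∧
    ∀ f : EuclideanSpace ℝ (Fin (d + 1)) → ℝ, ContinuousOn f (closure D) →
      IntegrableOn f D ∧
      IntegrableOn (fun x => f (φ x) * (fderiv ℝ φ x).det) Ω ∧
      (PreservesBoundaryOrientation Ω D φ →
        ∫ y in D, f y = ∫ x in Ω, f (φ x) * (fderiv ℝ φ x).det) ∧
      (ReversesBoundaryOrientation Ω D φ →
        ∫ y in D, f y = -∫ x in Ω, f (φ x) * (fderiv ℝ φ x).det) := by
  have hnt := frontier_nontrivial hΩ.isOpen hΩ.isConnected.1 hΩ.isBounded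
  have hd : d ≠ 0 := hpar.ne_zero_of_nontrivial hnt
  obtain ⟨p, hp⟩ := hnt.nonempty
  have hcases := boundaryJacobian_pos_or_neg hΩ.isOpen hD.isOpen hΩb hDb hφ hφb
    hpar.isPreconnected
  have hexcl := not_preserves_and_reverses hd hΩb hDb hφb.1.mapsTo hnt.nonempty
  refine ⟨hcases.imp preservesBoundaryOrientation_of_pos reversesBoundaryOrientation_of_neg,
    fun f hf => ⟨(hf.integrableOn_compact hD.isBounded.isCompact_closure).mono_set subset_closure,
      integrableOn_mul_det_fderiv hΩ.isOpen hΩ.isBounded (hΩb.uniqueDiffOn_closure hΩ.isOpen) hφ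
        (hf.comp hφ.continuousOn hφD), fun hpres => ?_, fun hrev => ?_⟩⟩
  · rw [setIntegral_comp_mul_det_eq d.succ_ne_zero hΩ.isOpen hΩ.isBounded hD.isOpen hD.isConnected
      hD.isBounded hΩb hDb hφ hφD hφb hp hf]
    rcases hcases with h | h
    · rw [Real.sign_of_pos (h p hp), one_mul]
    · exact (hexcl hpres (reversesBoundaryOrientation_of_neg h)).elim
  · rw [setIntegral_comp_mul_det_eq d.succ_ne_zero hΩ.isOpen hΩ.isBounded hD.isOpen hD.isConnected
      hD.isBounded hΩb hDb hφ hφD hφb hp hf]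
    rcases hcases with h | h
    · exact (hexcl (preservesBoundaryOrientation_of_pos h) hrev).elim
    · rw [Real.sign_of_neg (h p hp), neg_one_mul, neg_neg]
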